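/- **Setting.** Let $\eta=\mathrm{diag}(1,-1,-1,-1)$ and let $\mathcal W$ be the algebra of Wick polynomials of pure massless gravity: the graded-commutative complex algebra generated by the jet variables $d_{\mu_1}\cdots d_{\mu_n}\xi$ (completely symmetric in the $\mu_i$), where $\xi$ is one of the even variables $h_{\mu\nu}=h_{\nu\mu}$ (ghost number $0$) or of the odd variables $u_\rho$ (ghost number $1$), $\tilde u_\sigma$ (ghost number $-1$), modulo the equations of motion $\eta^{\mu\nu}d_\mu d_\nu\xi=0$ and their derivatives. Let $d_\mu$ be the formal derivatives, and let $d_Q$ be the odd derivation commuting with the $d_\mu$ with $$d_Qh_{\mu\nu}=-\tfrac i2\,(d_\mu u_\nu+d_\nu u_\mu-\eta_{\mu\nu}\,d_\rho u^\rho),\qquad d_Qu_\rho=0,\qquad d_Q\tilde u_\sigma=i\,d^\lambda h_{\sigma\lambda}.$$ The canonical dimension $\omega$ of a monomial is the number of its factors plus the number of derivatives in it. A *cochain of degree $k$* ($k\in\mathbb Z$) is a family $R(T^I(x_1),T^J(x_2))$, antisymmetric in the indices of each of the Lorentz multi-indices $I$, $J$, of quasi-local expressions, i.e. finite sums $\sum_\alpha\partial_\alpha\delta(x_1-x_2)\,N(T^I,T^J)^{\alpha}(x_2)$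 with $N(T^I,T^J)^\alpha\in\mathcal W$, which is covariant under the proper orthochronous Lorentz group and satisfies $$\mathrm{gh}\,N(T^I,T^J)^\alpha=|I|+|J|+k,\qquad \omega\bigl(N(T^I,T^J)^\alpha\bigr)\le 6+k-|\alpha|,$$ $$R(T^I(x_1),T^J(x_2))=(-1)^{|I||J|}R(T^J(x_2),T^I(x_1)).$$ Put $$(\delta R)(T^I(x_1),T^J(x_2))=\partial^1_\mu R(T^{I\mu}(x_1),T^J(x_2))+(-1)^{|I|}\,\partial^2_\mu R(T^I(x_1),T^{J\mu}(x_2)),$$ $s=d_Q-i\delta$ and $\bar s=d_Q+i\delta$. A *cocycle* is a cochain $R$ of degree $0$ with $sR=0$. Two cochains $R,R'$ of degree $0$ are *cohomologous* if $R-R'=\bar sB$ for some cochain $B$ of degree $-1$. **Theorem.** Let $R$ be a cocycle of the form $$R(T^I(x_1),T^J(x_2))=\delta(x_1-x_2)\,N(T^I,T^J)(x_2)+\partial_\mu\delta(x_1-x_2)\,N(T^I,T^J)^\mu(x_2)$$ for all $I,J$. Then $R$ is cohomologous to a cocycle $R'$ with $N'(T^I,T^J)^\mu=0$ for all $I,J$,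 i.e. of the form $$R'(T^I(x_1),T^J(x_2))=\delta(x_1-x_2)\,N'(T^I,T^J)(x_2).$$ -/

import Mathlib

open scoped Matrix

noncomputable section

namespace LinearGravity

/-- The Minkowski metric `diag(1,-1,-1,-1)`; it equals its own inverse, so the same matrix
serves for upper and lower indices. -/
def η : Matrix (Fin 4) (Fin 4) ℂ := Matrix.diagonal ![1, -1, -1, -1]

/-! ### The on-shell jet algebra (Wick polynomials) -/

/-- The basic fields of pure massless gravity, with lower indices: the symmetric tensor
`h_{μν}`, the ghost `u_ρ` and the anti-ghost `ũ_σ`. -/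
inductive FieldVar : Type
  | h (μ ν : Fin 4) : FieldVar
  | u (ρ : Fin 4) : FieldVar
  | ut (σ : Fin 4) : FieldVar

/-- Grassmann parity: `h` is even, `u` and `ũ` are odd. -/
def FieldVar.odd : FieldVar → Bool
  | .h _ _ => false
  | .u _ => true
  | .ut _ => true

/-- Ghost number of a basic field. -/
def FieldVar.ghost : FieldVar → ℤ
  | .h _ _ => 0
  | .u _ => 1
  | .ut _ => -1

/-- A jet variable `ξ_{a;μ₁…μₙ}`; it is completely symmetric in the derivative indices, which
therefore form a multiset. -/
abbrev Jet : Type := FieldVar × Multiset (Fin 4)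

/-- The sign `(-1)^{pq}`. -/
def koszul (p q : Bool) : ℂ := if p && q then -1 else 1

/-- The relations among the jet variables: graded commutativity, symmetry of `h_{μν}`, and the
equations of motion `η^{μν} d_μ d_ν ξ = 0` with all their derivatives. -/
inductive WickRel : FreeAlgebra ℂ Jet → FreeAlgebra ℂ Jet → Prop
  | comm (x y : Jet) : WickRel (FreeAlgebra.ι ℂ x * FreeAlgebra.ι ℂ y)
      (koszul x.1.odd y.1.odd • (FreeAlgebra.ι ℂ y * FreeAlgebra.ι ℂ x))
  | symm (μ ν : Fin 4) (α : Multiset (Fin 4)) :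
      WickRel (FreeAlgebra.ι ℂ (.h μ ν, α)) (FreeAlgebra.ι ℂ (.h ν μ, α))
  | eom (a : FieldVar) (α : Multiset (Fin 4)) :
      WickRel (∑ μ, ∑ ν, η μ ν • FreeAlgebra.ι ℂ (a, μ ::ₘ ν ::ₘ α)) 0

/-- The algebra of Wick polynomials: graded-commutative polynomials with complex coefficients in
the jet variables, modulo the equations of motion. -/
def Wick : Type := RingQuot WickRel

instance : Ring Wick := inferInstanceAs (Ring (RingQuot WickRel))

instance : Algebra ℂ Wick := inferInstanceAs (Algebra ℂ (RingQuot WickRel))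

/-- The jet variables as elements of the algebra. -/
def jet (x : Jet) : Wick := RingQuot.mkAlgHom ℂ WickRel (FreeAlgebra.ι ℂ x)

theorem jet_comm (x y : Jet) :
    jet x * jet y = koszul x.1.odd y.1.odd • (jet y * jet x) := by
  have h := RingQuot.mkAlgHom_rel ℂ (WickRel.comm x y)
  rw [map_mul, map_smul, map_mul] at h
  exact h

theorem jet_symm (μ ν : Fin 4) (α : Multiset (Fin 4)) : jet (.h μ ν, α) = jet (.h ν μ, α) :=
  RingQuot.mkAlgHom_rel ℂ (WickRel.symm μ ν α)

theorem jet_eom (a : FieldVar) (α : Multiset (Fin 4)) :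
    ∑ μ, ∑ ν, η μ ν • jet (a, μ ::ₘ ν ::ₘ α) = 0 := by
  have h := RingQuot.mkAlgHom_rel ℂ (WickRel.eom a α)
  simp only [map_sum, map_smul, map_zero] at h
  exact h

/-- The algebra morphism determined by the images of the jet variables. -/
def liftWick {A : Type} [Ring A] [Algebra ℂ A] (f : Jet → A)
    (hcomm : ∀ x y, f x * f y = koszul x.1.odd y.1.odd • (f y * f x))
    (hsymm : ∀ μ ν α, f (.h μ ν, α) = f (.h ν μ, α))
    (heom : ∀ a α, ∑ μ, ∑ ν, η μ ν • f (a, μ ::ₘ ν ::ₘ α) = 0) : Wick →ₐ[ℂ] A :=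
  RingQuot.liftAlgHom ℂ ⟨FreeAlgebra.lift ℂ f, by
    intro x y hxy
    cases hxy with
    | comm x y => simpa using hcomm x y
    | symm μ ν α => simpa using hsymm μ ν α
    | eom a α => simpa using heom a α⟩

theorem liftWick_jet {A : Type} [Ring A] [Algebra ℂ A] (f : Jet → A) (hcomm hsymm heom)
    (x : Jet) : liftWick f hcomm hsymm heom (jet x) = f x := by
  unfold liftWick jet
  erw [RingQuot.liftAlgHom_mkAlgHom_apply]
  simp

/-- The linear span of the jet variables of parity `p`. -/
def jetSpan (p : Bool) : Submodule ℂ Wick :=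
  Submodule.span ℂ {w | ∃ x : Jet, x.1.odd = p ∧ jet x = w}

theorem jet_mem_jetSpan (x : Jet) : jet x ∈ jetSpan x.1.odd :=
  Submodule.subset_span ⟨x, rfl, rfl⟩

theorem jetSpan_comm {p q : Bool} {v w : Wick} (hv : v ∈ jetSpan p) (hw : w ∈ jetSpan q) :
    v * w = koszul p q • (w * v) := by
  induction hv, hw using Submodule.span_induction₂ with
  | mem_mem v w hv hw =>
    obtain ⟨x, rfl, rfl⟩ := hv
    obtain ⟨y, rfl, rfl⟩ := hw
    exact jet_comm x y
  | zero_left => simp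
  | zero_right => simp
  | add_left _ _ _ _ _ _ h₁ h₂ => rw [add_mul, mul_add, h₁, h₂, smul_add]
  | add_right _ _ _ _ _ _ h₁ h₂ => rw [add_mul, mul_add, h₁, h₂, smul_add]
  | smul_left c _ _ _ _ h => rw [smul_mul_assoc, mul_smul_comm, h, smul_comm]
  | smul_right c _ _ _ _ h => rw [smul_mul_assoc, mul_smul_comm, h, smul_comm]

/-- The sign `(-1)^p`. -/
def paritySign (p : Bool) : ℂ := if p then -1 else 1

/-- The parity automorphism, multiplying every odd variable by `-1`. -/
def parity : Wick →ₐ[ℂ] Wick :=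
  liftWick (fun x => paritySign x.1.odd • jet x)
    (by
      intro x y
      simp only [smul_mul_assoc, mul_smul_comm]
      rw [jet_comm x y, smul_comm (paritySign y.1.odd) (paritySign x.1.odd),
        smul_comm (paritySign y.1.odd) (koszul _ _), smul_comm (paritySign x.1.odd) (koszul _ _)])
    (by
      intro μ ν α
      simp only [jet_symm μ ν α]
      rfl)
    (by
      intro a α
      simp only [smul_comm _ (paritySign a.odd), ← Finset.smul_sum]
      rw [jet_eom, smul_zero])

theorem parity_jet (x : Jet) : parity (jet x) = paritySign x.1.odd • jet x :=
  liftWick_jet _ _ _ _ x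

/-- The linear map `D` with `D 1 = 0`, `D (jet x) = f x` and the twisted Leibniz rule
`D (v w) = P v * D w + D v * w`, where `P` is an algebra endomorphism. It is the upper right
entry of the algebra morphism `w ↦ !![P w, D w; 0, w]`. -/
def twistedDerivation (P : Wick →ₐ[ℂ] Wick) (f : Jet → Wick)
    (hcomm : ∀ x y, P (jet x) * f y + f x * jet y =
      koszul x.1.odd y.1.odd • (P (jet y) * f x + f y * jet x))
    (hsymm : ∀ μ ν α, f (.h μ ν, α) = f (.h ν μ, α))
    (heom : ∀ a α, ∑ μ, ∑ ν, η μ ν • f (a, μ ::ₘ ν ::ₘ α) = 0) : Wick →ₗ[ℂ] Wick :=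
  Matrix.entryLinearMap ℂ Wick (0 : Fin 2) (1 : Fin 2) ∘ₗ
    (liftWick (A := Matrix (Fin 2) (Fin 2) Wick) (fun x => !![P (jet x), f x; 0, jet x])
      (by
        intro x y
        have hP : P (jet x) * P (jet y) = koszul x.1.odd y.1.odd • (P (jet y) * P (jet x)) := by
          rw [← map_mul, jet_comm x y, map_smul, map_mul]
        ext i j
        fin_cases i <;> fin_cases j <;>
          simp [Matrix.mul_apply, Fin.sum_univ_two, hP, hcomm x y, jet_comm x y])
      (by
        intro μ ν α
        rw [hsymm μ ν α, jet_symm μ ν α])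
      (by
        intro a α
        have hP : ∑ μ, ∑ ν, η μ ν • P (jet (a, μ ::ₘ ν ::ₘ α)) = 0 := by
          have h := congrArg P (jet_eom a α)
          simpa only [map_sum, map_smul, map_zero] using h
        ext i j
        fin_cases i <;> fin_cases j <;>
          simp only [Matrix.sum_apply, Matrix.smul_apply] <;>
          simp [hP, heom a α, jet_eom a α])).toLinearMap

theorem twistedDerivation_jet (P : Wick →ₐ[ℂ] Wick) (f : Jet → Wick) (hcomm hsymm heom)
    (x : Jet) : twistedDerivation P f hcomm hsymm heom (jet x) = f x := by
  simp [twistedDerivation, liftWick_jet]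

/-- The formal derivative `d_μ`, the derivation with `d_μ ξ_{a;α} = ξ_{a;μα}`. -/
def d (μ : Fin 4) : Wick →ₗ[ℂ] Wick :=
  twistedDerivation (AlgHom.id ℂ Wick) (fun x => jet (x.1, μ ::ₘ x.2))
    (by
      intro x y
      have h₁ := jet_comm x (y.1, μ ::ₘ y.2)
      have h₂ := jet_comm (x.1, μ ::ₘ x.2) y
      simp only [AlgHom.id_apply]
      rw [h₁, h₂, smul_add, add_comm])
    (fun ρ σ α => jet_symm ρ σ (μ ::ₘ α))
    (by
      intro a α
      have h := jet_eom a (μ ::ₘ α)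
      simpa only [Multiset.cons_swap μ] using h)

theorem d_jet (μ : Fin 4) (x : Jet) : d μ (jet x) = jet (x.1, μ ::ₘ x.2) :=
  twistedDerivation_jet _ _ _ _ _ x

/-- The action of the gauge charge on the jet variables:
`h_{μν} ↦ -(i/2) (d_μ u_ν + d_ν u_μ - η_{μν} d_ρ u^ρ)`, `u_ρ ↦ 0`, `ũ_σ ↦ i d^λ h_{σλ}`,
commuting with the derivatives. -/
def gaugeJet : Jet → Wick
  | (.h μ ν, α) => (-(Complex.I / 2)) • (jet (.u ν, μ ::ₘ α) + jet (.u μ, ν ::ₘ α)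
      - η μ ν • ∑ ρ, ∑ σ, η ρ σ • jet (.u σ, ρ ::ₘ α))
  | (.u _, _) => 0
  | (.ut σ, α) => Complex.I • ∑ l, ∑ l', η l l' • jet (.h σ l', l ::ₘ α)

theorem gaugeJet_mem (x : Jet) : gaugeJet x ∈ jetSpan (!x.1.odd) := by
  obtain ⟨a, α⟩ := x
  cases a with
  | h μ ν =>
    refine Submodule.smul_mem _ _ (Submodule.sub_mem _ (Submodule.add_mem _ ?_ ?_)
      (Submodule.smul_mem _ _ (Submodule.sum_mem _ fun ρ _ => Submodule.sum_mem _ fun σ _ =>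
        Submodule.smul_mem _ _ ?_)))
    · exact jet_mem_jetSpan (.u ν, _)
    · exact jet_mem_jetSpan (.u μ, _)
    · exact jet_mem_jetSpan (.u σ, _)
  | u ρ => exact Submodule.zero_mem _
  | ut σ =>
    refine Submodule.smul_mem _ _ (Submodule.sum_mem _ fun l _ => Submodule.sum_mem _ fun l' _ =>
      Submodule.smul_mem _ _ ?_)
    exact jet_mem_jetSpan (.h σ l', _)

/-- The families of elements, indexed by the derivative indices, that satisfy the equations of
motion. -/
def onShell : Submodule ℂ (Multiset (Fin 4) → Wick) where
  carrier := {g | ∀ α, ∑ μ, ∑ ν, η μ ν • g (μ ::ₘ ν ::ₘ α) = 0}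
  zero_mem' := by intro α; simp
  add_mem' := by
    intro g g' hg hg' α
    simp only [Pi.add_apply, smul_add, Finset.sum_add_distrib, hg α, hg' α, add_zero]
  smul_mem' := by
    intro c g hg α
    simp only [Pi.smul_apply, smul_comm _ c, ← Finset.smul_sum, hg α, smul_zero]

theorem jet_cons_onShell (a : FieldVar) (ρ : Fin 4) :
    (fun α => jet (a, ρ ::ₘ α)) ∈ onShell := by
  intro α
  have h := jet_eom a (ρ ::ₘ α)
  simpa only [Multiset.cons_swap ρ] using h

theorem gaugeJet_onShell (a : FieldVar) : (fun α => gaugeJet (a, α)) ∈ onShell := by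
  cases a with
  | h ρ σ =>
    have e : (fun α => gaugeJet (.h ρ σ, α)) = (-(Complex.I / 2)) •
        ((fun α => jet (.u σ, ρ ::ₘ α)) + (fun α => jet (.u ρ, σ ::ₘ α))
          - η ρ σ • ∑ κ, ∑ l, η κ l • fun α => jet (.u l, κ ::ₘ α)) := by
      funext α
      simp [gaugeJet]
    rw [e]
    exact Submodule.smul_mem _ _ (Submodule.sub_mem _
      (Submodule.add_mem _ (jet_cons_onShell _ _) (jet_cons_onShell _ _))
      (Submodule.smul_mem _ _ (Submodule.sum_mem _ fun κ _ => Submodule.sum_mem _ fun l _ =>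
        Submodule.smul_mem _ _ (jet_cons_onShell _ _))))
  | u ρ => exact Submodule.zero_mem _
  | ut σ =>
    have e : (fun α => gaugeJet (.ut σ, α)) = Complex.I •
        ∑ l, ∑ l', η l l' • fun α => jet (.h σ l', l ::ₘ α) := by
      funext α
      simp [gaugeJet]
    rw [e]
    exact Submodule.smul_mem _ _ (Submodule.sum_mem _ fun κ _ => Submodule.sum_mem _ fun l _ =>
        Submodule.smul_mem _ _ (jet_cons_onShell _ _))

/-- The gauge charge operator `d_Q`, an odd derivation commuting with the `d_μ`. -/
def dQ : Wick →ₗ[ℂ] Wick :=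
  twistedDerivation parity gaugeJet
    (by
      intro x y
      have h₁ := jetSpan_comm (jet_mem_jetSpan x) (gaugeJet_mem y)
      have h₂ := jetSpan_comm (gaugeJet_mem x) (jet_mem_jetSpan y)
      rw [parity_jet, parity_jet, smul_mul_assoc, smul_mul_assoc, h₁, h₂, smul_add, smul_smul,
        smul_smul]
      rw [add_comm]
      congr 2 <;> cases x.1.odd <;> cases y.1.odd <;> simp [koszul, paritySign])
    (by
      intro μ ν α
      have h : η μ ν = η ν μ := by
        simp only [η, Matrix.diagonal_apply]
        by_cases h : μ = ν
        · rw [h]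
        · rw [if_neg h, if_neg (Ne.symm h)]
      simp only [gaugeJet, h]
      rw [add_comm (jet (.u ν, _))])
    (fun a α => gaugeJet_onShell a α)

theorem dQ_jet (x : Jet) : dQ (jet x) = gaugeJet x :=
  twistedDerivation_jet _ _ _ _ _ x

/-! ### The Lorentz group -/

/-- The proper orthochronous Lorentz group. -/
structure Lorentz : Type where
  mat : Matrix (Fin 4) (Fin 4) ℝ
  isometry : (mat.map Complex.ofReal)ᵀ * η * mat.map Complex.ofReal = η
  det_eq_one : mat.det = 1
  orthochronous : 0 < mat 0 0

/-- The (real) entries of a Lorentz matrix as complex numbers. -/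
def Lorentz.toMatrix (Λ : Lorentz) : Matrix (Fin 4) (Fin 4) ℂ := Λ.mat.map Complex.ofReal

theorem η_mul_η : η * η = 1 := by
  rw [η, Matrix.diagonal_mul_diagonal, ← Matrix.diagonal_one]
  congr 1
  funext i
  fin_cases i <;> simp

theorem Lorentz.isometry' (Λ : Lorentz) : Λ.toMatrix * η * Λ.toMatrixᵀ = η := by
  have h : (η * Λ.toMatrixᵀ * η) * Λ.toMatrix = 1 := by
    rw [mul_assoc, mul_assoc, ← mul_assoc _ η Λ.toMatrix]
    have := Λ.isometry
    change Λ.toMatrixᵀ * η * Λ.toMatrix = η at this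
    rw [this, η_mul_η]
  have h' := mul_eq_one_comm.mp h
  calc Λ.toMatrix * η * Λ.toMatrixᵀ
      = (Λ.toMatrix * (η * Λ.toMatrixᵀ * η)) * η := by
        simp only [mul_assoc, η_mul_η, mul_one]
    _ = η := by rw [h', one_mul]

theorem Lorentz.sum_η (Λ : Lorentz) (ρ σ : Fin 4) :
    ∑ μ, ∑ ν, η μ ν * (Λ.toMatrix ρ μ * Λ.toMatrix σ ν) = η ρ σ := by
  have h := congrFun (congrFun Λ.isometry' ρ) σ
  simp only [Matrix.mul_apply, Matrix.transpose_apply, Finset.sum_mul] at h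
  rw [Finset.sum_comm] at h
  rw [← h]
  exact Finset.sum_congr rfl fun μ _ => Finset.sum_congr rfl fun ν _ => by ring

/-- `p ↦ p(d) ξ_b`, for a polynomial `p` in the four formal derivatives. -/
def jetPoly (b : FieldVar) : MvPolynomial (Fin 4) ℂ →ₗ[ℂ] Wick :=
  (MvPolynomial.basisMonomials (Fin 4) ℂ).constr ℂ fun m => jet (b, Finsupp.toMultiset m)

theorem jetPoly_monomial (b : FieldVar) (m : Fin 4 →₀ ℕ) :
    jetPoly b (MvPolynomial.monomial m 1) = jet (b, Finsupp.toMultiset m) := by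
  have h := (MvPolynomial.basisMonomials (Fin 4) ℂ).constr_basis ℂ
    (fun m => jet (b, Finsupp.toMultiset m)) m
  rwa [MvPolynomial.coe_basisMonomials] at h

theorem jetPoly_mem (b : FieldVar) (p : MvPolynomial (Fin 4) ℂ) :
    jetPoly b p ∈ jetSpan b.odd := by
  induction p using MvPolynomial.induction_on' with
  | monomial m c =>
    rw [← mul_one c, ← smul_eq_mul, ← MvPolynomial.smul_monomial, map_smul, jetPoly_monomial]
    exact Submodule.smul_mem _ _ (jet_mem_jetSpan (b, _))
  | add p q hp hq => rw [map_add]; exact Submodule.add_mem _ hp hq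

theorem jetPoly_symm (μ ν : Fin 4) : jetPoly (.h μ ν) = jetPoly (.h ν μ) := by
  refine (MvPolynomial.basisMonomials (Fin 4) ℂ).ext fun m => ?_
  rw [MvPolynomial.coe_basisMonomials, jetPoly_monomial, jetPoly_monomial, jet_symm]

/-- The wave operator as a polynomial in the derivatives. -/
def waveOp : MvPolynomial (Fin 4) ℂ :=
  ∑ μ, ∑ ν, η μ ν • (MvPolynomial.X μ * MvPolynomial.X ν)

theorem jetPoly_waveOp (b : FieldVar) (p : MvPolynomial (Fin 4) ℂ) :
    jetPoly b (waveOp * p) = 0 := by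
  induction p using MvPolynomial.induction_on' with
  | monomial m c =>
    have hc : MvPolynomial.monomial m c = c • MvPolynomial.monomial m (1 : ℂ) := by
      rw [MvPolynomial.smul_monomial, smul_eq_mul, mul_one]
    rw [hc, mul_smul_comm, map_smul]
    have h := jet_eom b (Finsupp.toMultiset m)
    have e : jetPoly b (waveOp * MvPolynomial.monomial m 1) =
        ∑ μ, ∑ ν, η μ ν • jet (b, μ ::ₘ ν ::ₘ Finsupp.toMultiset m) := by
      simp only [waveOp, Finset.sum_mul, map_sum, smul_mul_assoc, map_smul]
      refine Finset.sum_congr rfl fun μ _ => Finset.sum_congr rfl fun ν _ => ?_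
      rw [MvPolynomial.X, MvPolynomial.X, MvPolynomial.monomial_mul, MvPolynomial.monomial_mul,
        one_mul, one_mul, jetPoly_monomial]
      simp [Finsupp.toMultiset_add, Finsupp.toMultiset_single, add_assoc,
        Multiset.cons_swap ν μ]
    rw [e, h, smul_zero]
  | add p q hp hq => rw [mul_add, map_add, hp, hq, add_zero]

/-- The transformed derivative monomial: `d_μ ↦ Λ^ν_μ d_ν` in each factor. -/
def lorentzMonomial (Λ : Lorentz) (α : Multiset (Fin 4)) : MvPolynomial (Fin 4) ℂ :=
  (α.map fun μ => ∑ ν, Λ.toMatrix ν μ • MvPolynomial.X ν).prod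

theorem lorentzMonomial_eom (Λ : Lorentz) (α : Multiset (Fin 4)) :
    ∑ μ, ∑ ν, η μ ν • lorentzMonomial Λ (μ ::ₘ ν ::ₘ α) = waveOp * lorentzMonomial Λ α := by
  simp only [lorentzMonomial, Multiset.map_cons, Multiset.prod_cons, ← mul_assoc,
    ← smul_mul_assoc, ← Finset.sum_mul]
  congr 1
  simp only [waveOp, Finset.sum_mul, Finset.mul_sum, Finset.smul_sum, smul_mul_assoc,
    mul_smul_comm, smul_smul]
  calc _ = ∑ μ, ∑ ν, ∑ ρ, ∑ σ, (η μ ν * (Λ.toMatrix ρ μ * Λ.toMatrix σ ν)) •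
        (MvPolynomial.X ρ * MvPolynomial.X σ : MvPolynomial (Fin 4) ℂ) := by
        refine Finset.sum_congr rfl fun μ _ => Finset.sum_congr rfl fun ν _ => ?_
        rw [Finset.sum_comm]
        refine Finset.sum_congr rfl fun ρ _ => Finset.sum_congr rfl fun σ _ => ?_
        congr 1
        ring
    _ = ∑ ρ, ∑ σ, ∑ μ, ∑ ν, (η μ ν * (Λ.toMatrix ρ μ * Λ.toMatrix σ ν)) •
        (MvPolynomial.X ρ * MvPolynomial.X σ : MvPolynomial (Fin 4) ℂ) := by
        rw [Finset.sum_congr rfl fun μ _ => Finset.sum_comm, Finset.sum_comm]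
        refine Finset.sum_congr rfl fun ρ _ => ?_
        rw [Finset.sum_congr rfl fun μ _ => Finset.sum_comm, Finset.sum_comm]
    _ = _ := by
        refine Finset.sum_congr rfl fun ρ _ => Finset.sum_congr rfl fun σ _ => ?_
        simp only [← Finset.sum_smul]
        rw [Λ.sum_η]

/-- The action on the jet variables: every lower index transforms by `V_μ ↦ Λ^ν_μ V_ν`. -/
def lorentzJet (Λ : Lorentz) : Jet → Wick
  | (.h μ ν, α) => ∑ ρ, ∑ σ, (Λ.toMatrix ρ μ * Λ.toMatrix σ ν) •
      jetPoly (.h ρ σ) (lorentzMonomial Λ α)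
  | (.u μ, α) => ∑ ρ, Λ.toMatrix ρ μ • jetPoly (.u ρ) (lorentzMonomial Λ α)
  | (.ut μ, α) => ∑ ρ, Λ.toMatrix ρ μ • jetPoly (.ut ρ) (lorentzMonomial Λ α)

theorem lorentzJet_mem (Λ : Lorentz) (x : Jet) : lorentzJet Λ x ∈ jetSpan x.1.odd := by
  obtain ⟨a, α⟩ := x
  cases a with
  | h μ ν =>
    exact Submodule.sum_mem _ fun ρ _ => Submodule.sum_mem _ fun σ _ =>
      Submodule.smul_mem _ _ (jetPoly_mem (.h ρ σ) _)
  | u μ => exact Submodule.sum_mem _ fun ρ _ => Submodule.smul_mem _ _ (jetPoly_mem (.u ρ) _)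
  | ut μ => exact Submodule.sum_mem _ fun ρ _ => Submodule.smul_mem _ _ (jetPoly_mem (.ut ρ) _)

theorem lorentzPoly_onShell (Λ : Lorentz) (b : FieldVar) :
    (fun α => jetPoly b (lorentzMonomial Λ α)) ∈ onShell := by
  intro α
  have h := congrArg (jetPoly b) (lorentzMonomial_eom Λ α)
  rw [jetPoly_waveOp] at h
  simpa only [map_sum, map_smul] using h

theorem lorentzJet_onShell (Λ : Lorentz) (a : FieldVar) :
    (fun α => lorentzJet Λ (a, α)) ∈ onShell := by
  have key : ∀ a : FieldVar, (fun α => lorentzJet Λ (a, α)) ∈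
      Submodule.span ℂ {g | ∃ b, (fun α => jetPoly b (lorentzMonomial Λ α)) = g} := by
    intro a
    have m : ∀ b, (fun α => jetPoly b (lorentzMonomial Λ α)) ∈
      Submodule.span ℂ {g | ∃ b, (fun α => jetPoly b (lorentzMonomial Λ α)) = g} :=
      fun b => Submodule.subset_span ⟨b, rfl⟩
    cases a with
    | h μ ν =>
      convert Submodule.sum_mem _ fun ρ (_ : ρ ∈ Finset.univ) => Submodule.sum_mem _
        fun σ (_ : σ ∈ Finset.univ) => Submodule.smul_mem _
          (Λ.toMatrix ρ μ * Λ.toMatrix σ ν) (m (.h ρ σ)) using 1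
      funext α
      simp [lorentzJet]
    | u μ =>
      convert Submodule.sum_mem _ fun ρ (_ : ρ ∈ Finset.univ) => Submodule.smul_mem _
          (Λ.toMatrix ρ μ) (m (.u ρ)) using 1
      funext α
      simp [lorentzJet]
    | ut μ =>
      convert Submodule.sum_mem _ fun ρ (_ : ρ ∈ Finset.univ) => Submodule.smul_mem _
          (Λ.toMatrix ρ μ) (m (.ut ρ)) using 1
      funext α
      simp [lorentzJet]
  refine (Submodule.span_le.mpr ?_) (key a)
  rintro _ ⟨b, rfl⟩
  exact lorentzPoly_onShell Λ b

/-- The natural action of the Lorentz group on Wick polynomials by algebra morphisms. -/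
def lorentz (Λ : Lorentz) : Wick →ₐ[ℂ] Wick :=
  liftWick (lorentzJet Λ)
    (fun x y => jetSpan_comm (lorentzJet_mem Λ x) (lorentzJet_mem Λ y))
    (by
      intro μ ν α
      simp only [lorentzJet]
      rw [Finset.sum_comm]
      refine Finset.sum_congr rfl fun ρ _ => Finset.sum_congr rfl fun σ _ => ?_
      rw [jetPoly_symm, mul_comm])
    (fun a α => lorentzJet_onShell Λ a α)

/-! ### Ghost number and power counting -/

/-- The Wick monomial with the given factors. -/
def monomial (l : List Jet) : Wick := (l.map jet).prod

/-- The Wick polynomials of ghost number `g`. -/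
def ghostSubmodule (g : ℤ) : Submodule ℂ Wick :=
  Submodule.span ℂ {w | ∃ l : List Jet, (l.map fun x => x.1.ghost).sum = g ∧ monomial l = w}

/-- The Wick polynomials of canonical dimension `ω ≤ n`; every field and every derivative
counts `1`. -/
def dimSubmodule (n : ℤ) : Submodule ℂ Wick :=
  Submodule.span ℂ {w | ∃ l : List Jet,
    (l.map fun x => 1 + (Multiset.card x.2 : ℤ)).sum ≤ n ∧ monomial l = w}

/-! ### Quasi-local expressions -/

/-- Finite sums of `(∂_{μ₁}⋯∂_{μₙ} δ)(x₁ - x₂) W(x₂)` with Wick polynomials `W`. The value at the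
multiset `{μ₁,…,μₙ}` is the coefficient `W` of `∂_{μ₁}⋯∂_{μₙ} δ`. -/
abbrev QuasiLocal : Type := Multiset (Fin 4) →₀ Wick

/-- `δ(x₁ - x₂) W(x₂)`. -/
def deltaTerm (W : Wick) : QuasiLocal := Finsupp.single 0 W

/-- `∂_μ δ(x₁ - x₂) W(x₂)`. -/
def dDeltaTerm (μ : Fin 4) (W : Wick) : QuasiLocal := Finsupp.single {μ} W

/-- The derivative `∂/∂x₁^μ`. -/
def partial₁ (μ : Fin 4) : Module.End ℂ QuasiLocal :=
  Finsupp.lmapDomain Wick ℂ fun α => μ ::ₘ α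

/-- The derivative `∂/∂x₂^μ`; it acts on `(∂…∂δ)(x₁ - x₂)` by `-∂_μ` and on `W(x₂)` by `d_μ`. -/
def partial₂ (μ : Fin 4) : Module.End ℂ QuasiLocal :=
  Finsupp.mapRange.linearMap (d μ) - partial₁ μ

/-- The gauge charge acts on the Wick polynomials. -/
def gaugeQL : Module.End ℂ QuasiLocal := Finsupp.mapRange.linearMap dQ

/-- `D_{μ₁} ⋯ D_{μₙ}`, used for pairwise commuting operators `D_μ`. -/
def opProd (D : Fin 4 → Module.End ℂ QuasiLocal) (α : Multiset (Fin 4)) :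
    Module.End ℂ QuasiLocal :=
  (α.toList.map D).prod

/-- The exchange `x₁ ↔ x₂`: the expression `∂₁…∂₁ [δ(x₁ - x₂) W(x₂)]` becomes
`∂₂…∂₂ [δ(x₂ - x₁) W(x₁)] = ∂₂…∂₂ [δ(x₁ - x₂) W(x₂)]`. -/
def swap : Module.End ℂ QuasiLocal :=
  Finsupp.lsum ℂ fun α => opProd partial₂ α ∘ₗ Finsupp.lsingle 0

/-- The Lorentz group acts on the Wick polynomials and on the derivatives of `δ`. -/
def lorentzQL (Λ : Lorentz) : Module.End ℂ QuasiLocal :=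
  Finsupp.lsum ℂ fun α => opProd (fun μ => ∑ ν, Λ.toMatrix ν μ • partial₁ ν) α ∘ₗ
    Finsupp.lsingle 0 ∘ₗ (lorentz Λ).toLinearMap

/-! ### Cochains -/

/-- A family `R(T^I(x₁), T^J(x₂))` of quasi-local expressions, indexed by pairs of finite
sequences of upper Lorentz indices. -/
abbrev Cochain : Type := List (Fin 4) → List (Fin 4) → QuasiLocal

/-- `∑ L_{μ₁ν₁} ⋯ L_{μₙνₙ} F(ν₁…νₙ)`, the sum over all `ν₁, …, νₙ`. -/
def tensorTransform (L : Matrix (Fin 4) (Fin 4) ℂ) :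
    List (Fin 4) → (List (Fin 4) → QuasiLocal) → QuasiLocal
  | [], F => F []
  | μ :: I, F => ∑ ν, L μ ν • tensorTransform L I fun I' => F (ν :: I')

/-- Cochains of degree `k`. -/
structure IsCochain (k : ℤ) (R : Cochain) : Prop where
  antisymm_left : ∀ I₁ μ ν I₂ J, R (I₁ ++ μ :: ν :: I₂) J = -R (I₁ ++ ν :: μ :: I₂) J
  antisymm_right : ∀ I J₁ μ ν J₂, R I (J₁ ++ μ :: ν :: J₂) = -R I (J₁ ++ ν :: μ :: J₂)
  /-- Ghost number `|I| + |J| + k`. -/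
  ghost_number : ∀ I J α, R I J α ∈ ghostSubmodule (I.length + J.length + k)
  /-- The coefficient of an `n`-th derivative of `δ` has canonical dimension `≤ 6 + k - n`. -/
  power_counting : ∀ I J α, R I J α ∈ dimSubmodule (6 + k - Multiset.card α)
  /-- Lorentz covariance, with `T^I` and `T^J` transforming as contravariant tensors. -/
  covariant : ∀ (Λ : Lorentz) I J, lorentzQL Λ (R I J) =
    tensorTransform Λ.toMatrix⁻¹ I fun I' => tensorTransform Λ.toMatrix⁻¹ J fun J' => R I' J'
  /-- `R(T^I(x₁), T^J(x₂)) = (-1)^{|I||J|} R(T^J(x₂), T^I(x₁))`. -/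
  symmetric : ∀ I J, R I J = (-1 : ℂ) ^ (I.length * J.length) • swap (R J I)

/-- `(δR)(T^I(x₁), T^J(x₂)) = ∂¹_μ R(T^{Iμ}(x₁), T^J(x₂)) + (-1)^{|I|} ∂²_μ R(T^I(x₁), T^{Jμ}(x₂))`. -/
def deltaOp (R : Cochain) : Cochain := fun I J =>
  ∑ μ, (partial₁ μ (R (I ++ [μ]) J) + (-1 : ℂ) ^ I.length • partial₂ μ (R I (J ++ [μ])))

/-- `s = d_Q - i δ`. -/
def s (R : Cochain) : Cochain := fun I J => gaugeQL (R I J) - Complex.I • deltaOp R I J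

/-- `s̄ = d_Q + i δ`. -/
def sBar (R : Cochain) : Cochain := fun I J => gaugeQL (R I J) + Complex.I • deltaOp R I J

/-- A cocycle is a cochain of degree `0` that is annihilated by `s`. -/
def IsCocycle (R : Cochain) : Prop := IsCochain 0 R ∧ s R = 0

/-- Two cochains are cohomologous if they differ by `s̄ B` for a cochain `B` of degree `-1`. -/
def Cohomologous (R R' : Cochain) : Prop := ∃ B : Cochain, IsCochain (-1) B ∧ R - R' = sBar B

end LinearGravity

end

noncomputable section

namespace LinearGravity

/-! ### Induction on Wick polynomials and Leibniz rules -/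

/-! For a cochain `δ b` of order zero, the first-order part of `s̄ (δ b)` has coefficients `i
(b(T^{Iμ}, T^J) - (-1)^{|I|} b(T^I, T^{Jμ}))`. It therefore suffices to solve the equation that
equates these with `N₁(T^I, T^J)^μ`, within cochains of degree `-1`.

Read as a recursion in `|I|` with `b(∅, T^J) = 0`, the equation always has a unique solution,
`primitive`. What has to be proved is that this solution is a cochain. The critical point is
antisymmetry in `I`. Two steps of the recursion express the part of `b(T^{Iμν}, T^J)` symmetric in
`μ, ν` through exactly the combination of the `N₁` that vanishes by the second-order part of `s R =
0` (`second_order_of_form`, `primitive_antisymm_left`). The exchange symmetry of `R` makes `N₁`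
graded antisymmetric under `I ↔ J`, so the graded transpose of a solution is again a solution, and
the average `symmPrimitive` has the required symmetry (`symmPrimitive_spec`). Ghost number,
dimension and covariance are inherited along the recursion; `exists_primitive` collects all this.

The difference `R - s̄ (δ b)` then has order zero (`sub_sBar_deltaTerm`). It is annihilated by `s`
because `s s̄ = 0` (`s_sBar`), which rests on `d_Q² = 0`, `δ² = 0` and `d_Q δ = δ d_Q`. Its cochain
properties are checked on the remaining coefficient, `reducedCoeff`; for this `d_Q` and `d_μ` must
respect the gradings and the Lorentz action. -/

theorem wick_induction {motive : Wick → Prop} (algebraMap : ∀ c : ℂ, motive (algebraMap ℂ Wick c))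
    (jet : ∀ x, motive (jet x)) (mul : ∀ v w, motive v → motive w → motive (v * w))
    (add : ∀ v w, motive v → motive w → motive (v + w)) (w : Wick) : motive w := by
  obtain ⟨a, rfl⟩ := RingQuot.mkAlgHom_surjective ℂ WickRel w
  refine FreeAlgebra.induction ℂ Jet (motive := fun a => motive (RingQuot.mkAlgHom ℂ WickRel a))
    ?_ jet ?_ ?_ a
  · intro c
    rw [AlgHom.commutes]
    exact algebraMap c
  · intro a b ha hb
    rw [map_mul]
    exact mul _ _ ha hb
  · intro a b ha hb
    rw [map_add]
    exact add _ _ ha hb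

section TwistedDerivation

variable (P : Wick →ₐ[ℂ] Wick) (f : Jet → Wick) (hcomm hsymm heom)

/-- Once the other three entries of the defining matrix morphism are identified on all of `Wick`,
its multiplicativity, read in the upper right entry, is the twisted Leibniz rule. -/
theorem twistedDerivation_spec : ∃ φ : Wick →ₐ[ℂ] Matrix (Fin 2) (Fin 2) Wick, ∀ w,
    φ w = !![P w, twistedDerivation P f hcomm hsymm heom w; 0, w] := by
  obtain ⟨φ, hφ, hD⟩ : ∃ φ : Wick →ₐ[ℂ] Matrix (Fin 2) (Fin 2) Wick,
      (∀ x, φ (jet x) = !![P (jet x), f x; 0, jet x]) ∧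
        ∀ w, twistedDerivation P f hcomm hsymm heom w = φ w 0 1 :=
    ⟨_, fun x => liftWick_jet _ _ _ _ x, fun w => rfl⟩
  have h : ∀ w, φ w 0 0 = P w ∧ φ w 1 0 = 0 ∧ φ w 1 1 = w := by
    intro w
    induction w using wick_induction with
    | algebraMap c => simp [AlgHom.commutes, Matrix.algebraMap_matrix_apply]
    | jet x => simp [hφ]
    | mul v w hv hw => simp [Matrix.mul_apply, hv, hw]
    | add v w hv hw => simp [hv, hw]
  refine ⟨φ, fun w => ?_⟩
  obtain ⟨h₀, h₁, h₂⟩ := h w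
  ext i j
  fin_cases i <;> fin_cases j
  · exact h₀
  · exact (hD w).symm
  · exact h₁
  · exact h₂

theorem twistedDerivation_mul (v w : Wick) :
    twistedDerivation P f hcomm hsymm heom (v * w) =
      P v * twistedDerivation P f hcomm hsymm heom w +
        twistedDerivation P f hcomm hsymm heom v * w := by
  obtain ⟨φ, hφ⟩ := twistedDerivation_spec P f hcomm hsymm heom
  have h := congrFun (congrFun (map_mul φ v w) 0) 1
  simpa [hφ, Matrix.mul_apply] using h

theorem twistedDerivation_algebraMap (c : ℂ) :
    twistedDerivation P f hcomm hsymm heom (algebraMap ℂ Wick c) = 0 := by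
  obtain ⟨φ, hφ⟩ := twistedDerivation_spec P f hcomm hsymm heom
  have h := congrFun (congrFun (φ.commutes c) 0) 1
  rw [hφ, Matrix.algebraMap_matrix_apply] at h
  simpa using h

end TwistedDerivation

theorem d_mul (μ : Fin 4) (v w : Wick) : d μ (v * w) = v * d μ w + d μ v * w :=
  twistedDerivation_mul _ _ _ _ _ v w

theorem d_algebraMap (μ : Fin 4) (c : ℂ) : d μ (algebraMap ℂ Wick c) = 0 :=
  twistedDerivation_algebraMap _ _ _ _ _ c

theorem dQ_mul (v w : Wick) : dQ (v * w) = parity v * dQ w + dQ v * w :=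
  twistedDerivation_mul _ _ _ _ _ v w

theorem dQ_algebraMap (c : ℂ) : dQ (algebraMap ℂ Wick c) = 0 :=
  twistedDerivation_algebraMap _ _ _ _ _ c

/-! ### Commutation relations -/

theorem parity_of_mem {p : Bool} {w : Wick} (hw : w ∈ jetSpan p) :
    parity w = paritySign p • w := by
  induction hw using Submodule.span_induction with
  | mem w hw =>
    obtain ⟨x, rfl, rfl⟩ := hw
    exact parity_jet x
  | zero => simp
  | add v w _ _ hv hw => rw [map_add, hv, hw, smul_add]
  | smul c w _ hw => rw [map_smul, hw, smul_comm]

theorem parity_d (μ : Fin 4) (w : Wick) : parity (d μ w) = d μ (parity w) := by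
  induction w using wick_induction with
  | algebraMap c => rw [d_algebraMap, AlgHom.commutes, d_algebraMap, map_zero]
  | jet x => rw [d_jet, parity_jet, parity_jet, map_smul, d_jet]
  | mul v w hv hw => simp only [d_mul, map_mul, map_add, hv, hw]
  | add v w hv hw => simp only [map_add, hv, hw]

/-- This sign is what cancels the two cross terms when `d_Q²` is applied to a product in `dQ_dQ`. -/
theorem parity_dQ (w : Wick) : parity (dQ w) = -dQ (parity w) := by
  induction w using wick_induction with
  | algebraMap c => rw [dQ_algebraMap, AlgHom.commutes, dQ_algebraMap, map_zero, neg_zero]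
  | jet x =>
    rw [dQ_jet, parity_of_mem (gaugeJet_mem x), parity_jet, map_smul, dQ_jet, ← neg_smul]
    cases x.1.odd <;> simp [paritySign]
  | mul v w hv hw =>
    simp only [dQ_mul, map_mul, map_add, hv, hw, mul_neg, neg_mul, neg_add]
  | add v w hv hw => simp only [map_add, hv, hw, neg_add]

theorem d_comm (μ ν : Fin 4) (w : Wick) : d μ (d ν w) = d ν (d μ w) := by
  induction w using wick_induction with
  | algebraMap c => simp only [d_algebraMap, map_zero]
  | jet x => simp only [d_jet, Multiset.cons_swap μ ν]
  | mul v w hv hw => simp only [d_mul, map_add, hv, hw]; abel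
  | add v w hv hw => simp only [map_add, hv, hw]

theorem d_gaugeJet (μ : Fin 4) (x : Jet) : d μ (gaugeJet x) = gaugeJet (x.1, μ ::ₘ x.2) := by
  obtain ⟨a, α⟩ := x
  cases a with
  | h ρ σ =>
    simp only [gaugeJet, map_smul, map_sub, map_add, map_sum, d_jet, Multiset.cons_swap μ]
  | u ρ => simp only [gaugeJet, map_zero]
  | ut σ => simp only [gaugeJet, map_smul, map_sum, d_jet, Multiset.cons_swap μ]

theorem dQ_d (μ : Fin 4) (w : Wick) : dQ (d μ w) = d μ (dQ w) := by
  induction w using wick_induction with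
  | algebraMap c => rw [d_algebraMap, dQ_algebraMap, map_zero, map_zero]
  | jet x => rw [d_jet, dQ_jet, dQ_jet, d_gaugeJet]
  | mul v w hv hw =>
    simp only [d_mul, dQ_mul, map_add, hv, hw, parity_d]
    abel
  | add v w hv hw => simp only [map_add, hv, hw]

theorem η_apply (μ ν : Fin 4) : η μ ν = if μ = ν then (![1, -1, -1, -1] : Fin 4 → ℂ) μ else 0 :=
  Matrix.diagonal_apply _ _ _

/-- Only `ũ_σ` is not immediate. In `d_Q² ũ_σ` the divergence term `d_σ d_λ u^λ` cancels against the
trace term of `d_Q h`, which leaves `½ □ u_σ`; this vanishes by the equation of motion of `u_σ`. The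
factor `-(i · i/2) = ½` reappears in the final linear combination. -/
theorem dQ_gaugeJet (x : Jet) : dQ (gaugeJet x) = 0 := by
  obtain ⟨a, α⟩ := x
  cases a with
  | h ρ σ => simp only [gaugeJet, map_smul, map_sub, map_add, map_sum, dQ_jet]; simp
  | u ρ => simp only [gaugeJet, map_zero]
  | ut σ =>
    have h := jet_eom (.u σ) α
    simp only [gaugeJet, map_smul, map_sum, dQ_jet]
    simp only [η_apply, Fin.sum_univ_four] at h ⊢
    fin_cases σ <;> simp [Fin.ext_iff] at h ⊢ <;>
      simp only [Multiset.cons_swap (1 : Fin 4) 0, Multiset.cons_swap (2 : Fin 4) 0, Multiset.cons_swap (3 : Fin 4) 0,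
        Multiset.cons_swap (2 : Fin 4) 1, Multiset.cons_swap (3 : Fin 4) 1, Multiset.cons_swap (3 : Fin 4) 2] <;>
      linear_combination (norm := module) (-(Complex.I * (Complex.I / 2))) • h

theorem dQ_dQ (w : Wick) : dQ (dQ w) = 0 := by
  induction w using wick_induction with
  | algebraMap c => rw [dQ_algebraMap, map_zero]
  | jet x => rw [dQ_jet, dQ_gaugeJet]
  | mul v w hv hw =>
    rw [dQ_mul, map_add, dQ_mul, dQ_mul, hv, hw, parity_dQ]
    simp
  | add v w hv hw => rw [map_add, map_add, hv, hw, add_zero]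

/-! ### Ghost number and canonical dimension -/

theorem jet_mem_ghostSubmodule (x : Jet) : jet x ∈ ghostSubmodule x.1.ghost :=
  Submodule.subset_span ⟨[x], by simp, by simp [monomial]⟩

theorem mul_mem_ghostSubmodule {g g' : ℤ} {v w : Wick} (hv : v ∈ ghostSubmodule g)
    (hw : w ∈ ghostSubmodule g') : v * w ∈ ghostSubmodule (g + g') := by
  induction hv, hw using Submodule.span_induction₂ with
  | mem_mem v w hv hw =>
    obtain ⟨l, rfl, rfl⟩ := hv
    obtain ⟨l', rfl, rfl⟩ := hw
    exact Submodule.subset_span ⟨l ++ l', by simp, by simp [monomial]⟩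
  | zero_left => simp
  | zero_right => simp
  | add_left _ _ _ _ _ _ h₁ h₂ => rw [add_mul]; exact add_mem h₁ h₂
  | add_right _ _ _ _ _ _ h₁ h₂ => rw [mul_add]; exact add_mem h₁ h₂
  | smul_left c _ _ _ _ h => rw [smul_mul_assoc]; exact Submodule.smul_mem _ _ h
  | smul_right c _ _ _ _ h => rw [mul_smul_comm]; exact Submodule.smul_mem _ _ h

theorem jet_mem_dimSubmodule (x : Jet) : jet x ∈ dimSubmodule (1 + Multiset.card x.2) :=
  Submodule.subset_span ⟨[x], by simp, by simp [monomial]⟩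

theorem dimSubmodule_mono {m n : ℤ} (h : m ≤ n) : dimSubmodule m ≤ dimSubmodule n :=
  Submodule.span_mono fun _ ⟨l, hl, e⟩ => ⟨l, hl.trans h, e⟩

theorem mul_mem_dimSubmodule {m n : ℤ} {v w : Wick} (hv : v ∈ dimSubmodule m)
    (hw : w ∈ dimSubmodule n) : v * w ∈ dimSubmodule (m + n) := by
  induction hv, hw using Submodule.span_induction₂ with
  | mem_mem v w hv hw =>
    obtain ⟨l, hl, rfl⟩ := hv
    obtain ⟨l', hl', rfl⟩ := hw
    refine Submodule.subset_span ⟨l ++ l', ?_, by simp [monomial]⟩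
    rw [List.map_append, List.sum_append]
    exact add_le_add hl hl'
  | zero_left => simp
  | zero_right => simp
  | add_left _ _ _ _ _ _ h₁ h₂ => rw [add_mul]; exact add_mem h₁ h₂
  | add_right _ _ _ _ _ _ h₁ h₂ => rw [mul_add]; exact add_mem h₁ h₂
  | smul_left c _ _ _ _ h => rw [smul_mul_assoc]; exact Submodule.smul_mem _ _ h
  | smul_right c _ _ _ _ h => rw [mul_smul_comm]; exact Submodule.smul_mem _ _ h

theorem monomial_cons (x : Jet) (l : List Jet) : monomial (x :: l) = jet x * monomial l := by
  simp [monomial]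

theorem monomial_mem_ghostSubmodule (l : List Jet) :
    monomial l ∈ ghostSubmodule (l.map fun x => x.1.ghost).sum :=
  Submodule.subset_span ⟨l, rfl, rfl⟩

theorem monomial_mem_dimSubmodule (l : List Jet) :
    monomial l ∈ dimSubmodule (l.map fun x => 1 + (Multiset.card x.2 : ℤ)).sum :=
  Submodule.subset_span ⟨l, le_rfl, rfl⟩

/-- A twisted derivation that raises the ghost number of the jet variables by `k` does so on all
Wick polynomials. -/
theorem leibniz_mem_ghostSubmodule (D : Wick →ₗ[ℂ] Wick) (P : Wick →ₐ[ℂ] Wick) (c : Jet → ℂ)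
    (k : ℤ) (hone : D 1 = 0) (hmul : ∀ v w, D (v * w) = P v * D w + D v * w)
    (hP : ∀ x, P (jet x) = c x • jet x) (hjet : ∀ x, D (jet x) ∈ ghostSubmodule (x.1.ghost + k))
    {g : ℤ} {w : Wick} (hw : w ∈ ghostSubmodule g) : D w ∈ ghostSubmodule (g + k) := by
  refine (Submodule.span_le (p := (ghostSubmodule (g + k)).comap D)).mpr ?_ hw
  rintro _ ⟨l, rfl, rfl⟩
  clear hw
  change D (monomial l) ∈ ghostSubmodule _
  induction l with
  | nil => simp [monomial, hone]
  | cons x l ih =>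
    rw [monomial_cons, hmul, hP, smul_mul_assoc, List.map_cons, List.sum_cons]
    refine add_mem (Submodule.smul_mem _ _ ?_) ?_
    · rw [add_assoc]
      exact mul_mem_ghostSubmodule (jet_mem_ghostSubmodule x) ih
    · rw [add_right_comm]
      exact mul_mem_ghostSubmodule (hjet x) (monomial_mem_ghostSubmodule l)

/-- A twisted derivation that raises the canonical dimension of the jet variables by `k` does so on
all Wick polynomials. -/
theorem leibniz_mem_dimSubmodule (D : Wick →ₗ[ℂ] Wick) (P : Wick →ₐ[ℂ] Wick) (c : Jet → ℂ)
    (k : ℤ) (hone : D 1 = 0) (hmul : ∀ v w, D (v * w) = P v * D w + D v * w)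
    (hP : ∀ x, P (jet x) = c x • jet x)
    (hjet : ∀ x, D (jet x) ∈ dimSubmodule (1 + Multiset.card x.2 + k))
    {n : ℤ} {w : Wick} (hw : w ∈ dimSubmodule n) : D w ∈ dimSubmodule (n + k) := by
  refine (Submodule.span_le (p := (dimSubmodule (n + k)).comap D)).mpr ?_ hw
  rintro _ ⟨l, hl, rfl⟩
  -- The bound `n` is replaced by the exact dimension of the monomial, which is additive over the
  -- factors and so suits induction on the list.
  refine dimSubmodule_mono (add_le_add_left hl k) ?_
  clear hl hw
  induction l with
  | nil => simp [monomial, hone]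
  | cons x l ih =>
    rw [monomial_cons, hmul, hP, smul_mul_assoc, List.map_cons, List.sum_cons]
    refine add_mem (Submodule.smul_mem _ _ ?_) ?_
    · rw [add_assoc]
      exact mul_mem_dimSubmodule (jet_mem_dimSubmodule x) ih
    · rw [add_right_comm]
      exact mul_mem_dimSubmodule (hjet x) (monomial_mem_dimSubmodule l)

theorem d_one (μ : Fin 4) : d μ 1 = 0 := by
  rw [← map_one (algebraMap ℂ Wick), d_algebraMap]

theorem dQ_one : dQ 1 = 0 := by
  rw [← map_one (algebraMap ℂ Wick), dQ_algebraMap]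

theorem d_mem_ghostSubmodule (μ : Fin 4) {g : ℤ} {w : Wick} (hw : w ∈ ghostSubmodule g) :
    d μ w ∈ ghostSubmodule g := by
  rw [← add_zero g]
  refine leibniz_mem_ghostSubmodule (d μ) (AlgHom.id ℂ Wick) 1 0 (d_one μ) (d_mul μ)
    (fun x => by simp) (fun x => ?_) hw
  rw [d_jet, add_zero]
  exact jet_mem_ghostSubmodule (x.1, μ ::ₘ x.2)

theorem d_mem_dimSubmodule (μ : Fin 4) {n : ℤ} {w : Wick} (hw : w ∈ dimSubmodule n) :
    d μ w ∈ dimSubmodule (n + 1) := by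
  refine leibniz_mem_dimSubmodule (d μ) (AlgHom.id ℂ Wick) 1 1 (d_one μ) (d_mul μ)
    (fun x => by simp) (fun x => ?_) hw
  rw [d_jet]
  have h := jet_mem_dimSubmodule (x.1, μ ::ₘ x.2)
  rwa [Multiset.card_cons, Nat.cast_succ, ← add_assoc] at h

theorem dQ_mem_ghostSubmodule {g : ℤ} {w : Wick} (hw : w ∈ ghostSubmodule g) :
    dQ w ∈ ghostSubmodule (g + 1) := by
  refine leibniz_mem_ghostSubmodule dQ parity (fun x => paritySign x.1.odd) 1 dQ_one dQ_mul
    parity_jet (fun x => ?_) hw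
  rw [dQ_jet]
  obtain ⟨a, α⟩ := x
  cases a with
  | h μ ν =>
    refine Submodule.smul_mem _ _ (Submodule.sub_mem _ (Submodule.add_mem _ ?_ ?_)
      (Submodule.smul_mem _ _ (Submodule.sum_mem _ fun ρ _ => Submodule.sum_mem _ fun σ _ =>
        Submodule.smul_mem _ _ ?_)))
    · exact jet_mem_ghostSubmodule (.u ν, _)
    · exact jet_mem_ghostSubmodule (.u μ, _)
    · exact jet_mem_ghostSubmodule (.u σ, _)
  | u ρ => exact Submodule.zero_mem _
  | ut σ =>
    refine Submodule.smul_mem _ _ (Submodule.sum_mem _ fun l _ => Submodule.sum_mem _ fun l' _ =>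
      Submodule.smul_mem _ _ ?_)
    exact jet_mem_ghostSubmodule (.h σ l', _)

theorem dQ_mem_dimSubmodule {n : ℤ} {w : Wick} (hw : w ∈ dimSubmodule n) :
    dQ w ∈ dimSubmodule (n + 1) := by
  refine leibniz_mem_dimSubmodule dQ parity (fun x => paritySign x.1.odd) 1 dQ_one dQ_mul
    parity_jet (fun x => ?_) hw
  rw [dQ_jet]
  have hj : ∀ (a : FieldVar) (ρ : Fin 4) (α : Multiset (Fin 4)),
      jet (a, ρ ::ₘ α) ∈ dimSubmodule (1 + Multiset.card α + 1) := by
    intro a ρ α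
    have h := jet_mem_dimSubmodule (a, ρ ::ₘ α)
    rwa [Multiset.card_cons, Nat.cast_succ, ← add_assoc] at h
  obtain ⟨a, α⟩ := x
  cases a with
  | h μ ν =>
    exact Submodule.smul_mem _ _ (Submodule.sub_mem _ (Submodule.add_mem _ (hj _ _ _) (hj _ _ _))
      (Submodule.smul_mem _ _ (Submodule.sum_mem _ fun ρ _ => Submodule.sum_mem _ fun σ _ =>
        Submodule.smul_mem _ _ (hj _ _ _))))
  | u ρ => exact Submodule.zero_mem _
  | ut σ =>
    exact Submodule.smul_mem _ _ (Submodule.sum_mem _ fun l _ => Submodule.sum_mem _ fun l' _ =>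
      Submodule.smul_mem _ _ (hj _ _ _))

/-! ### The Lorentz action and the derivations -/

theorem lorentz_jet (Λ : Lorentz) (x : Jet) : lorentz Λ (jet x) = lorentzJet Λ x :=
  liftWick_jet _ _ _ _ x

theorem d_jetPoly (ν : Fin 4) (b : FieldVar) (p : MvPolynomial (Fin 4) ℂ) :
    d ν (jetPoly b p) = jetPoly b (MvPolynomial.X ν * p) := by
  induction p using MvPolynomial.induction_on' with
  | monomial m c =>
    have hc : MvPolynomial.monomial m c = c • MvPolynomial.monomial m (1 : ℂ) := by
      rw [MvPolynomial.smul_monomial, smul_eq_mul, mul_one]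
    rw [hc, mul_smul_comm, map_smul, map_smul, map_smul, MvPolynomial.X,
      MvPolynomial.monomial_mul, one_mul, jetPoly_monomial, jetPoly_monomial, d_jet]
    simp [Finsupp.toMultiset_add, Finsupp.toMultiset_single]
  | add p q hp hq => rw [map_add, map_add, hp, hq, mul_add, map_add]

theorem lorentzMonomial_cons (Λ : Lorentz) (μ : Fin 4) (α : Multiset (Fin 4)) :
    lorentzMonomial Λ (μ ::ₘ α) =
      ∑ ν, Λ.toMatrix ν μ • (MvPolynomial.X ν * lorentzMonomial Λ α) := by
  simp only [lorentzMonomial, Multiset.map_cons, Multiset.prod_cons, Finset.sum_mul,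
    smul_mul_assoc]

theorem jetPoly_lorentzMonomial_cons (Λ : Lorentz) (b : FieldVar) (μ : Fin 4)
    (α : Multiset (Fin 4)) : jetPoly b (lorentzMonomial Λ (μ ::ₘ α)) =
      ∑ ν, Λ.toMatrix ν μ • d ν (jetPoly b (lorentzMonomial Λ α)) := by
  simp only [lorentzMonomial_cons, map_sum, map_smul, d_jetPoly]

theorem lorentz_d (Λ : Lorentz) (μ : Fin 4) (w : Wick) :
    lorentz Λ (d μ w) = ∑ ν, Λ.toMatrix ν μ • d ν (lorentz Λ w) := by
  induction w using wick_induction with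
  | algebraMap c => simp only [d_algebraMap, AlgHom.commutes, map_zero, smul_zero,
      Finset.sum_const_zero]
  | jet x =>
    rw [d_jet, lorentz_jet, lorentz_jet]
    obtain ⟨a, α⟩ := x
    cases a with
    | h ρ σ =>
      simp only [lorentzJet, jetPoly_lorentzMonomial_cons, map_sum, map_smul, Finset.smul_sum]
      simp only [Fin.sum_univ_four]
      module
    | u ρ =>
      simp only [lorentzJet, jetPoly_lorentzMonomial_cons, map_sum, map_smul, Finset.smul_sum]
      rw [Finset.sum_comm]
      simp only [smul_comm (Λ.toMatrix _ ρ)]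
    | ut ρ =>
      simp only [lorentzJet, jetPoly_lorentzMonomial_cons, map_sum, map_smul, Finset.smul_sum]
      rw [Finset.sum_comm]
      simp only [smul_comm (Λ.toMatrix _ ρ)]
  | mul v w hv hw =>
    simp only [d_mul, map_mul, map_add, hv, hw, Finset.mul_sum, Finset.sum_mul, smul_add,
      Finset.sum_add_distrib, mul_smul_comm, smul_mul_assoc]
  | add v w hv hw => simp only [map_add, hv, hw, smul_add, Finset.sum_add_distrib]

theorem parity_lorentz (Λ : Lorentz) (w : Wick) :
    parity (lorentz Λ w) = lorentz Λ (parity w) := by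
  induction w using wick_induction with
  | algebraMap c => simp only [AlgHom.commutes]
  | jet x =>
    rw [parity_jet, map_smul, lorentz_jet, parity_of_mem (lorentzJet_mem Λ x)]
  | mul v w hv hw => simp only [map_mul, hv, hw]
  | add v w hv hw => simp only [map_add, hv, hw]

/-! ### Lorentz invariance of the gauge charge -/

theorem jetPoly_induction (b : FieldVar) (T T' : Wick →ₗ[ℂ] Wick)
    (h : ∀ α, T (jet (b, α)) = T' (jet (b, α))) (p : MvPolynomial (Fin 4) ℂ) :
    T (jetPoly b p) = T' (jetPoly b p) := by
  induction p using MvPolynomial.induction_on' with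
  | monomial m c =>
    have hc : MvPolynomial.monomial m c = c • MvPolynomial.monomial m (1 : ℂ) := by
      rw [MvPolynomial.smul_monomial, smul_eq_mul, mul_one]
    rw [hc, map_smul, map_smul, map_smul, jetPoly_monomial, h]
  | add p q hp hq => simp only [map_add, hp, hq]

theorem dQ_jetPoly_u (ρ : Fin 4) (p : MvPolynomial (Fin 4) ℂ) : dQ (jetPoly (.u ρ) p) = 0 :=
  jetPoly_induction (.u ρ) dQ 0 (fun α => by rw [dQ_jet]; rfl) p

theorem dQ_jetPoly_h (ρ σ : Fin 4) (p : MvPolynomial (Fin 4) ℂ) :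
    dQ (jetPoly (.h ρ σ) p) = (-(Complex.I / 2)) • (d ρ (jetPoly (.u σ) p) +
      d σ (jetPoly (.u ρ) p) - η ρ σ • ∑ κ, ∑ l, η κ l • d κ (jetPoly (.u l) p)) := by
  induction p using MvPolynomial.induction_on' with
  | monomial m c =>
    have hc : MvPolynomial.monomial m c = c • MvPolynomial.monomial m (1 : ℂ) := by
      rw [MvPolynomial.smul_monomial, smul_eq_mul, mul_one]
    simp only [hc, map_smul, jetPoly_monomial, dQ_jet, d_jet, gaugeJet, smul_comm _ c,
      ← Finset.smul_sum, ← smul_add, ← smul_sub]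
  | add p q hp hq =>
    simp only [map_add, hp, hq, smul_add, Finset.sum_add_distrib]
    module

theorem dQ_jetPoly_ut (σ : Fin 4) (p : MvPolynomial (Fin 4) ℂ) :
    dQ (jetPoly (.ut σ) p) =
      Complex.I • ∑ l, ∑ l', η l l' • d l (jetPoly (.h σ l') p) := by
  induction p using MvPolynomial.induction_on' with
  | monomial m c =>
    have hc : MvPolynomial.monomial m c = c • MvPolynomial.monomial m (1 : ℂ) := by
      rw [MvPolynomial.smul_monomial, smul_eq_mul, mul_one]
    simp only [hc, map_smul, jetPoly_monomial, dQ_jet, d_jet, gaugeJet, smul_comm _ c,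
      ← Finset.smul_sum]
  | add p q hp hq => simp only [map_add, hp, hq, smul_add, Finset.sum_add_distrib]

/-- This is `Λᵀ η Λ = η`, the invariance of `η` as a tensor with lower indices, whereas
`Lorentz.sum_η` is `Λ η Λᵀ = η` and governs contractions. -/
theorem Lorentz.sum_η' (Λ : Lorentz) (μ ν : Fin 4) :
    ∑ ρ, ∑ σ, (Λ.toMatrix ρ μ * Λ.toMatrix σ ν) * η ρ σ = η μ ν := by
  have h := congrFun (congrFun Λ.isometry μ) ν
  simp only [Matrix.mul_apply, Matrix.transpose_apply, Finset.sum_mul] at h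
  rw [Finset.sum_comm] at h
  rw [← h]
  exact Finset.sum_congr rfl fun ρ _ => Finset.sum_congr rfl fun σ _ => by
    simp only [Lorentz.toMatrix]; ring

/-- Contraction of the two indices of a Lorentz transformed tensor. -/
theorem Lorentz.contract (Λ : Lorentz) (F : Fin 4 → Fin 4 → Wick) :
    ∑ μ, ∑ ν, η μ ν • ∑ ρ, ∑ σ, (Λ.toMatrix ρ μ * Λ.toMatrix σ ν) • F ρ σ =
      ∑ ρ, ∑ σ, η ρ σ • F ρ σ := by
  simp only [Finset.smul_sum, smul_smul]
  calc _ = ∑ ρ, ∑ σ, ∑ μ, ∑ ν, (η μ ν * (Λ.toMatrix ρ μ * Λ.toMatrix σ ν)) • F ρ σ := by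
        rw [Finset.sum_congr rfl fun μ _ => Finset.sum_comm, Finset.sum_comm]
        refine Finset.sum_congr rfl fun ρ _ => ?_
        rw [Finset.sum_congr rfl fun μ _ => Finset.sum_comm, Finset.sum_comm]
    _ = _ := by
        refine Finset.sum_congr rfl fun ρ _ => Finset.sum_congr rfl fun σ _ => ?_
        simp only [← Finset.sum_smul]
        rw [Λ.sum_η]

/-- On jets, `d_Q` is assembled from derivatives, contractions and `η`, all of which are covariant.
Products follow from the Leibniz rule because the Lorentz action preserves parity. -/
theorem dQ_lorentz (Λ : Lorentz) (w : Wick) : dQ (lorentz Λ w) = lorentz Λ (dQ w) := by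
  induction w using wick_induction with
  | algebraMap c => rw [AlgHom.commutes, dQ_algebraMap, map_zero]
  | jet x =>
    rw [dQ_jet, lorentz_jet]
    obtain ⟨a, α⟩ := x
    cases a with
    | h μ ν =>
      have ht := Λ.contract fun κ l => d κ (jetPoly (.u l) (lorentzMonomial Λ α))
      have he : ∑ κ, ∑ l, η κ l • lorentzJet Λ (.u l, κ ::ₘ α) =
          ∑ κ, ∑ l, η κ l • d κ (jetPoly (.u l) (lorentzMonomial Λ α)) := by
        rw [← ht]
        refine Finset.sum_congr rfl fun κ _ => Finset.sum_congr rfl fun l _ => ?_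
        simp only [lorentzJet, jetPoly_lorentzMonomial_cons, Finset.smul_sum, smul_smul]
        rw [Finset.sum_comm]
        refine Finset.sum_congr rfl fun κ' _ => Finset.sum_congr rfl fun l' _ => ?_
        ring_nf
      simp only [gaugeJet, map_smul, map_sub, map_add, map_sum, lorentz_jet, he]
      simp only [lorentzJet, map_sum, map_smul, dQ_jetPoly_h, jetPoly_lorentzMonomial_cons]
      generalize ∑ κ, ∑ l, η κ l • d κ (jetPoly (.u l) (lorentzMonomial Λ α)) = Z
      -- Writing `η μ ν` as its own transform gives the trace term the same transformation
      -- coefficients as the two derivative terms, so that the sums can be compared termwise.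
      rw [← Λ.sum_η' μ ν]
      simp only [Finset.sum_smul, Finset.smul_sum, smul_sub, smul_add, Finset.sum_sub_distrib,
        Finset.sum_add_distrib]
      refine congrArg₂ _ (congrArg₂ _ ?_ ?_) ?_
      · rw [Finset.sum_comm]
        refine Finset.sum_congr rfl fun κ' _ => Finset.sum_congr rfl fun l' _ => ?_
        module
      · refine Finset.sum_congr rfl fun κ' _ => Finset.sum_congr rfl fun l' _ => ?_
        module
      · refine Finset.sum_congr rfl fun κ' _ => Finset.sum_congr rfl fun l' _ => ?_
        module
    | u ρ => simp only [lorentzJet, gaugeJet, map_sum, map_smul, dQ_jetPoly_u, map_zero,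
        smul_zero, Finset.sum_const_zero]
    | ut σ =>
      simp only [gaugeJet, map_smul, map_sum, lorentz_jet]
      simp only [lorentzJet, map_sum, map_smul, dQ_jetPoly_ut, jetPoly_lorentzMonomial_cons]
      have ht := fun τ => Λ.contract fun κ l => d κ (jetPoly (.h τ l) (lorentzMonomial Λ α))
      simp only [← ht]
      simp only [Finset.smul_sum]
      rw [Finset.sum_comm]
      refine Finset.sum_congr rfl fun l _ => ?_
      rw [Finset.sum_comm]
      refine Finset.sum_congr rfl fun l' _ => Finset.sum_congr rfl fun τ _ => ?_
      rw [Finset.sum_comm]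
      refine Finset.sum_congr rfl fun κ _ => Finset.sum_congr rfl fun κ' _ => ?_
      module
  | mul v w hv hw => simp only [map_mul, dQ_mul, map_add, hv, hw, parity_lorentz]
  | add v w hv hw => simp only [map_add, hv, hw]

/-! ### Operators on quasi-local expressions of order at most one -/

theorem deltaTerm_add (v w : Wick) : deltaTerm (v + w) = deltaTerm v + deltaTerm w :=
  Finsupp.single_add _ _ _

theorem deltaTerm_sub (v w : Wick) : deltaTerm (v - w) = deltaTerm v - deltaTerm w :=
  Finsupp.single_sub _ _ _

theorem deltaTerm_smul (c : ℂ) (w : Wick) : deltaTerm (c • w) = c • deltaTerm w :=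
  (Finsupp.smul_single _ _ _).symm

theorem deltaTerm_zero : deltaTerm 0 = 0 := Finsupp.single_zero _

theorem deltaTerm_sum {ι : Type*} (t : Finset ι) (f : ι → Wick) :
    deltaTerm (∑ i ∈ t, f i) = ∑ i ∈ t, deltaTerm (f i) :=
  map_sum (Finsupp.singleAddHom 0) f t

theorem dDeltaTerm_sub (μ : Fin 4) (v w : Wick) :
    dDeltaTerm μ (v - w) = dDeltaTerm μ v - dDeltaTerm μ w :=
  Finsupp.single_sub _ _ _

theorem dDeltaTerm_smul (μ : Fin 4) (c : ℂ) (w : Wick) :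
    dDeltaTerm μ (c • w) = c • dDeltaTerm μ w :=
  (Finsupp.smul_single _ _ _).symm

theorem gaugeQL_deltaTerm (w : Wick) : gaugeQL (deltaTerm w) = deltaTerm (dQ w) := by
  simp [gaugeQL, deltaTerm]

theorem partial₁_single (μ : Fin 4) (α : Multiset (Fin 4)) (w : Wick) :
    partial₁ μ (Finsupp.single α w) = Finsupp.single (μ ::ₘ α) w := by
  simp [partial₁]

theorem partial₂_single (μ : Fin 4) (α : Multiset (Fin 4)) (w : Wick) :
    partial₂ μ (Finsupp.single α w) =
      Finsupp.single α (d μ w) - Finsupp.single (μ ::ₘ α) w := by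
  simp [partial₂, partial₁_single]

theorem partial₁_deltaTerm (μ : Fin 4) (w : Wick) :
    partial₁ μ (deltaTerm w) = dDeltaTerm μ w :=
  partial₁_single μ 0 w

theorem partial₂_deltaTerm (μ : Fin 4) (w : Wick) :
    partial₂ μ (deltaTerm w) = deltaTerm (d μ w) - dDeltaTerm μ w :=
  partial₂_single μ 0 w

theorem swap_deltaTerm (w : Wick) : swap (deltaTerm w) = deltaTerm w := by
  simp [swap, deltaTerm, opProd]

theorem swap_dDeltaTerm (μ : Fin 4) (w : Wick) :
    swap (dDeltaTerm μ w) = deltaTerm (d μ w) - dDeltaTerm μ w := by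
  rw [← partial₂_deltaTerm]
  simp [swap, deltaTerm, dDeltaTerm, opProd]

theorem lorentzQL_deltaTerm (Λ : Lorentz) (w : Wick) :
    lorentzQL Λ (deltaTerm w) = deltaTerm (lorentz Λ w) := by
  simp [lorentzQL, deltaTerm, opProd]

theorem lorentzQL_dDeltaTerm (Λ : Lorentz) (μ : Fin 4) (w : Wick) :
    lorentzQL Λ (dDeltaTerm μ w) = ∑ ν, Λ.toMatrix ν μ • dDeltaTerm ν (lorentz Λ w) := by
  conv_rhs => simp only [← partial₁_deltaTerm]
  simp [lorentzQL, deltaTerm, dDeltaTerm, opProd]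

theorem deltaTerm_apply_zero (w : Wick) : deltaTerm w 0 = w := Finsupp.single_eq_same

theorem deltaTerm_apply_of_ne {α : Multiset (Fin 4)} (h : α ≠ 0) (w : Wick) :
    deltaTerm w α = 0 := Finsupp.single_eq_of_ne h

theorem dDeltaTerm_apply_zero (μ : Fin 4) (w : Wick) : dDeltaTerm μ w 0 = 0 :=
  Finsupp.single_eq_of_ne (Multiset.singleton_ne_zero μ).symm

theorem dDeltaTerm_apply_singleton (μ ν : Fin 4) (w : Wick) :
    dDeltaTerm μ w {ν} = if μ = ν then w else 0 := by
  simp [dDeltaTerm, Finsupp.single_apply]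

/-! ### The operators `s` and `s̄` -/

theorem gaugeQL_apply (r : QuasiLocal) (α : Multiset (Fin 4)) : gaugeQL r α = dQ (r α) := by
  simp [gaugeQL]

theorem gaugeQL_gaugeQL (r : QuasiLocal) : gaugeQL (gaugeQL r) = 0 := by
  ext α
  rw [gaugeQL_apply, gaugeQL_apply, dQ_dQ, Finsupp.zero_apply]

theorem gaugeQL_single (α : Multiset (Fin 4)) (w : Wick) :
    gaugeQL (Finsupp.single α w) = Finsupp.single α (dQ w) := by
  simp [gaugeQL]

theorem gaugeQL_partial₁ (μ : Fin 4) (r : QuasiLocal) :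
    gaugeQL (partial₁ μ r) = partial₁ μ (gaugeQL r) := by
  induction r using Finsupp.induction_linear with
  | zero => simp only [map_zero]
  | add r t hr ht => simp only [map_add, hr, ht]
  | single α w => simp only [partial₁_single, gaugeQL_single]

theorem gaugeQL_partial₂ (μ : Fin 4) (r : QuasiLocal) :
    gaugeQL (partial₂ μ r) = partial₂ μ (gaugeQL r) := by
  induction r using Finsupp.induction_linear with
  | zero => simp only [map_zero]
  | add r t hr ht => simp only [map_add, hr, ht]
  | single α w => simp only [partial₂_single, map_sub, gaugeQL_single, dQ_d]

theorem partial₁_comm (μ ν : Fin 4) (r : QuasiLocal) :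
    partial₁ μ (partial₁ ν r) = partial₁ ν (partial₁ μ r) := by
  induction r using Finsupp.induction_linear with
  | zero => simp only [map_zero]
  | add r t hr ht => simp only [map_add, hr, ht]
  | single α w => simp only [partial₁_single, Multiset.cons_swap μ ν]

theorem partial₁_partial₂ (μ ν : Fin 4) (r : QuasiLocal) :
    partial₁ μ (partial₂ ν r) = partial₂ ν (partial₁ μ r) := by
  induction r using Finsupp.induction_linear with
  | zero => simp only [map_zero]
  | add r t hr ht => simp only [map_add, hr, ht]
  | single α w => simp only [partial₁_single, partial₂_single, map_sub, Multiset.cons_swap μ ν]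

theorem partial₂_comm (μ ν : Fin 4) (r : QuasiLocal) :
    partial₂ μ (partial₂ ν r) = partial₂ ν (partial₂ μ r) := by
  induction r using Finsupp.induction_linear with
  | zero => simp only [map_zero]
  | add r t hr ht => simp only [map_add, hr, ht]
  | single α w =>
    simp only [partial₂_single, map_sub, Multiset.cons_swap μ ν, d_comm μ ν]
    abel

theorem sum_sum_eq_zero_of_antisymm (F : Fin 4 → Fin 4 → QuasiLocal)
    (hF : ∀ μ ν, F μ ν = -F ν μ) : ∑ μ, ∑ ν, F μ ν = 0 := by
  have h : ∑ μ, ∑ ν, F μ ν + ∑ μ, ∑ ν, F μ ν = 0 := by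
    nth_rewrite 2 [Finset.sum_comm]
    simp only [← Finset.sum_add_distrib]
    refine Finset.sum_eq_zero fun μ _ => Finset.sum_eq_zero fun ν _ => ?_
    rw [hF μ ν, neg_add_cancel]
  have h' : ∑ μ, ∑ ν, F μ ν = (1 / 2 : ℂ) • (∑ μ, ∑ ν, F μ ν + ∑ μ, ∑ ν, F μ ν) := by
    module
  rw [h', h, smul_zero]

/-- Within one slot, commuting derivatives are contracted with antisymmetric indices. The two mixed
terms agree up to the signs `(-1)^{|I|+1}` and `(-1)^{|I|}`, and cancel. -/
theorem deltaOp_deltaOp {R : Cochain}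
    (hleft : ∀ I₁ μ ν I₂ J, R (I₁ ++ μ :: ν :: I₂) J = -R (I₁ ++ ν :: μ :: I₂) J)
    (hright : ∀ I J₁ μ ν J₂, R I (J₁ ++ μ :: ν :: J₂) = -R I (J₁ ++ ν :: μ :: J₂)) :
    deltaOp (deltaOp R) = 0 := by
  funext I J
  have h₁ : ∑ μ, ∑ ν, partial₁ μ (partial₁ ν (R (I ++ [μ] ++ [ν]) J)) = 0 := by
    refine sum_sum_eq_zero_of_antisymm _ fun μ ν => ?_
    have h := hleft I μ ν [] J
    simp only [List.append_assoc, List.cons_append, List.nil_append]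
    rw [h, map_neg, map_neg, partial₁_comm]
  have h₂ : ∑ μ, ∑ ν, partial₂ μ (partial₂ ν (R I (J ++ [μ] ++ [ν]))) = 0 := by
    refine sum_sum_eq_zero_of_antisymm _ fun μ ν => ?_
    have h := hright I J μ ν []
    simp only [List.append_assoc, List.cons_append, List.nil_append]
    rw [h, map_neg, map_neg, partial₂_comm]
  have hsign : (-1 : ℂ) ^ I.length * (-1 : ℂ) ^ I.length = 1 := by
    rw [← mul_pow]; norm_num
  have h₃ : ∑ μ, ∑ ν, partial₁ μ (partial₂ ν (R (I ++ [μ]) (J ++ [ν]))) =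
      ∑ μ, ∑ ν, partial₂ μ (partial₁ ν (R (I ++ [ν]) (J ++ [μ]))) := by
    rw [Finset.sum_comm]
    simp only [partial₁_partial₂]
  calc deltaOp (deltaOp R) I J
      = ∑ μ, ∑ ν, partial₁ μ (partial₁ ν (R (I ++ [μ] ++ [ν]) J)) +
        (-1 : ℂ) ^ (I.length + 1) •
          ∑ μ, ∑ ν, partial₁ μ (partial₂ ν (R (I ++ [μ]) (J ++ [ν]))) +
        ((-1 : ℂ) ^ I.length • ∑ μ, ∑ ν, partial₂ μ (partial₁ ν (R (I ++ [ν]) (J ++ [μ]))) +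
        ((-1 : ℂ) ^ I.length * (-1 : ℂ) ^ I.length) •
          ∑ μ, ∑ ν, partial₂ μ (partial₂ ν (R I (J ++ [μ] ++ [ν])))) := by
        simp only [deltaOp, map_sum, map_add, map_smul, Finset.sum_add_distrib, Finset.smul_sum,
          smul_add, smul_smul, List.length_append, List.length_singleton]
    _ = 0 := by
        rw [h₁, h₂, h₃, pow_succ, mul_neg_one, neg_smul]
        simp

theorem gaugeQL_deltaOp (R : Cochain) (I J : List (Fin 4)) :
    gaugeQL (deltaOp R I J) = deltaOp (fun I' J' => gaugeQL (R I' J')) I J := by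
  simp only [deltaOp, map_sum, map_add, map_smul, gaugeQL_partial₁, gaugeQL_partial₂]

theorem deltaOp_add (R R' : Cochain) : deltaOp (R + R') = deltaOp R + deltaOp R' := by
  funext I J
  simp only [deltaOp, Pi.add_apply, map_add, smul_add, ← Finset.sum_add_distrib]
  exact Finset.sum_congr rfl fun μ _ => by abel

theorem deltaOp_smul (c : ℂ) (R : Cochain) : deltaOp (c • R) = c • deltaOp R := by
  funext I J
  simp only [deltaOp, Pi.smul_apply, map_smul, Finset.smul_sum, smul_add, smul_comm c]

theorem s_sub (R R' : Cochain) : s (R - R') = s R - s R' := by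
  funext I J
  have h : deltaOp (R - R') I J = deltaOp R I J - deltaOp R' I J := by
    simp only [deltaOp, Pi.sub_apply, map_sub, smul_sub, ← Finset.sum_sub_distrib]
    exact Finset.sum_congr rfl fun μ _ => by abel
  simp only [s, h, Pi.sub_apply, map_sub, smul_sub]
  abel

/-- Formally `(d_Q - iδ)(d_Q + iδ) = d_Q² + δ² + i (d_Q δ - δ d_Q)`. Since `d_Q` commutes with `δ`
instead of anticommuting, it is the product with opposite signs that vanishes. -/
theorem s_sBar {R : Cochain}
    (hleft : ∀ I₁ μ ν I₂ J, R (I₁ ++ μ :: ν :: I₂) J = -R (I₁ ++ ν :: μ :: I₂) J)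
    (hright : ∀ I J₁ μ ν J₂, R I (J₁ ++ μ :: ν :: J₂) = -R I (J₁ ++ ν :: μ :: J₂)) :
    s (sBar R) = 0 := by
  have hs : sBar R = (fun I J => gaugeQL (R I J)) + Complex.I • deltaOp R := rfl
  funext I J
  simp only [s, hs, deltaOp_add, deltaOp_smul, deltaOp_deltaOp hleft hright, Pi.add_apply,
    Pi.smul_apply, map_add, map_smul, gaugeQL_gaugeQL, gaugeQL_deltaOp, Pi.zero_apply]
  simp

/-! ### Tensor transformations -/

section TensorTransform

variable (L : Matrix (Fin 4) (Fin 4) ℂ)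

theorem tensorTransform_add (I : List (Fin 4)) (F G : List (Fin 4) → QuasiLocal) :
    tensorTransform L I (F + G) = tensorTransform L I F + tensorTransform L I G := by
  induction I generalizing F G with
  | nil => rfl
  | cons μ I ih =>
    simp only [tensorTransform, ← Finset.sum_add_distrib, ← smul_add, ← ih]
    rfl

theorem tensorTransform_smul (I : List (Fin 4)) (c : ℂ) (F : List (Fin 4) → QuasiLocal) :
    tensorTransform L I (c • F) = c • tensorTransform L I F := by
  induction I generalizing F with
  | nil => rfl
  | cons μ I ih =>
    simp only [tensorTransform, Finset.smul_sum, smul_comm c, ← ih]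
    rfl

/-- `tensorTransform` as a linear map. -/
def tensorTransformLinear (I : List (Fin 4)) : (List (Fin 4) → QuasiLocal) →ₗ[ℂ] QuasiLocal where
  toFun := tensorTransform L I
  map_add' := tensorTransform_add L I
  map_smul' := tensorTransform_smul L I

theorem tensorTransform_sum (I : List (Fin 4)) (F : Fin 4 → List (Fin 4) → QuasiLocal) :
    tensorTransform L I (fun I' => ∑ ν, F ν I') = ∑ ν, tensorTransform L I (F ν) := by
  have h := map_sum (tensorTransformLinear L I) F Finset.univ
  rw [← Finset.sum_fn]
  exact h

theorem tensorTransform_map (T : QuasiLocal →ₗ[ℂ] QuasiLocal) (I : List (Fin 4))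
    (F : List (Fin 4) → QuasiLocal) :
    T (tensorTransform L I F) = tensorTransform L I fun I' => T (F I') := by
  induction I generalizing F with
  | nil => rfl
  | cons μ I ih => simp only [tensorTransform, map_sum, map_smul, ih]

/-- Only sequences of the length of `I` enter the sum; hence signs depending on `|I|` and `|J|`
behave as constants under the transformation. -/
theorem tensorTransform_congr (I : List (Fin 4)) {F G : List (Fin 4) → QuasiLocal}
    (h : ∀ I', I'.length = I.length → F I' = G I') :
    tensorTransform L I F = tensorTransform L I G := by
  induction I generalizing F G with
  | nil => exact h [] rfl
  | cons μ I ih =>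
    simp only [tensorTransform]
    refine Finset.sum_congr rfl fun ν _ => ?_
    rw [ih fun I' hI' => h (ν :: I') (by simp [hI'])]

theorem tensorTransform_snoc (I : List (Fin 4)) (μ : Fin 4) (F : List (Fin 4) → QuasiLocal) :
    tensorTransform L (I ++ [μ]) F =
      ∑ ν, L μ ν • tensorTransform L I fun I' => F (I' ++ [ν]) := by
  induction I generalizing F with
  | nil => simp [tensorTransform]
  | cons κ I ih =>
    simp only [List.cons_append, tensorTransform, ih, Finset.smul_sum]
    rw [Finset.sum_comm]
    simp only [smul_comm (L κ _)]

theorem tensorTransform_comm (I J : List (Fin 4)) (F : List (Fin 4) → List (Fin 4) → QuasiLocal) :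
    tensorTransform L I (fun I' => tensorTransform L J (F I')) =
      tensorTransform L J fun J' => tensorTransform L I fun I' => F I' J' := by
  induction I generalizing F with
  | nil => rfl
  | cons μ I ih =>
    simp only [tensorTransform, ih]
    rw [tensorTransform_sum L J fun ν J' =>
      L μ ν • tensorTransform L I fun I' => F (ν :: I') J']
    refine Finset.sum_congr rfl fun ν _ => ?_
    exact (tensorTransform_smul L J (L μ ν) _).symm

/-- The transformation of a family with two multi-indices. -/
def tensorTransform₂ (I J : List (Fin 4)) : Cochain →ₗ[ℂ] QuasiLocal where
  toFun F := tensorTransform L I fun I' => tensorTransform L J fun J' => F I' J'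
  map_add' F G := by
    rw [← tensorTransform_add]
    exact congrArg _ (funext fun I' => tensorTransform_add L J (F I') (G I'))
  map_smul' c F := by
    rw [RingHom.id_apply, ← tensorTransform_smul]
    exact congrArg _ (funext fun I' => tensorTransform_smul L J c (F I'))

variable (I J : List (Fin 4)) (F : Cochain)

theorem tensorTransform₂_map (T : QuasiLocal →ₗ[ℂ] QuasiLocal) :
    T (tensorTransform₂ L I J F) = tensorTransform₂ L I J fun I' J' => T (F I' J') :=
  (tensorTransform_map L T I _).trans
    (congrArg _ (funext fun _ => tensorTransform_map L T J _))

theorem tensorTransform₂_congr {F G : Cochain}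
    (h : ∀ I' J', I'.length = I.length → J'.length = J.length → F I' J' = G I' J') :
    tensorTransform₂ L I J F = tensorTransform₂ L I J G :=
  tensorTransform_congr L I fun I' hI => tensorTransform_congr L J fun J' hJ => h I' J' hI hJ

theorem tensorTransform₂_transpose :
    tensorTransform₂ L I J F = tensorTransform₂ L J I fun J' I' => F I' J' :=
  tensorTransform_comm L I J F

theorem tensorTransform₂_snoc_left (μ : Fin 4) : tensorTransform₂ L (I ++ [μ]) J F =
    ∑ ν, L μ ν • tensorTransform₂ L I J fun I' J' => F (I' ++ [ν]) J' :=
  tensorTransform_snoc L I μ _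

theorem tensorTransform₂_snoc_right (μ : Fin 4) : tensorTransform₂ L I (J ++ [μ]) F =
    ∑ ν, L μ ν • tensorTransform₂ L I J fun I' J' => F I' (J' ++ [ν]) := by
  rw [tensorTransform₂_transpose, tensorTransform₂_snoc_left]
  exact Finset.sum_congr rfl fun ν _ => by rw [tensorTransform₂_transpose]

end TensorTransform

theorem Lorentz.isUnit_det (Λ : Lorentz) : IsUnit Λ.toMatrix.det := by
  have h : Λ.toMatrix.det = Complex.ofRealHom Λ.mat.det := 
    (RingHom.map_det Complex.ofRealHom Λ.mat).symm
  rw [h, Λ.det_eq_one, map_one]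
  exact isUnit_one

theorem Lorentz.sum_mul_inv (Λ : Lorentz) (μ ν : Fin 4) :
    ∑ κ, Λ.toMatrix μ κ * Λ.toMatrix⁻¹ κ ν = if μ = ν then 1 else 0 := by
  rw [← Matrix.mul_apply, Matrix.mul_nonsing_inv _ Λ.isUnit_det, Matrix.one_apply]

theorem Lorentz.sum_inv_mul (Λ : Lorentz) (μ ν : Fin 4) :
    ∑ κ, Λ.toMatrix⁻¹ μ κ * Λ.toMatrix κ ν = if μ = ν then 1 else 0 := by
  rw [← Matrix.mul_apply, Matrix.nonsing_inv_mul _ Λ.isUnit_det, Matrix.one_apply]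

/-! ### Covariant families of Wick polynomials -/

/-- Lorentz covariance of a family `W(T^I, T^J)` of Wick polynomials. -/
def IsCovariant (F : List (Fin 4) → List (Fin 4) → Wick) : Prop :=
  ∀ (Λ : Lorentz) I J, deltaTerm (lorentz Λ (F I J)) =
    tensorTransform₂ Λ.toMatrix⁻¹ I J fun I' J' => deltaTerm (F I' J')

namespace IsCovariant

variable {F G : List (Fin 4) → List (Fin 4) → Wick}

theorem add (hF : IsCovariant F) (hG : IsCovariant G) : IsCovariant fun I J => F I J + G I J := by
  intro Λ I J
  rw [map_add, deltaTerm_add, hF, hG, ← map_add]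
  simp only [deltaTerm_add]
  rfl

theorem smul (c : ℕ → ℕ → ℂ) (hF : IsCovariant F) :
    IsCovariant fun I J => c I.length J.length • F I J := by
  intro Λ I J
  rw [map_smul, deltaTerm_smul, hF, ← map_smul]
  refine tensorTransform₂_congr _ _ _ fun I' J' hI hJ => ?_
  simp only [hI, hJ, deltaTerm_smul]
  rfl

theorem transpose (hF : IsCovariant F) : IsCovariant fun I J => F J I := by
  intro Λ I J
  rw [hF, tensorTransform₂_transpose]

theorem gauge (hF : IsCovariant F) : IsCovariant fun I J => dQ (F I J) := by
  intro Λ I J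
  rw [← dQ_lorentz, ← gaugeQL_deltaTerm, hF, tensorTransform₂_map]
  simp only [gaugeQL_deltaTerm]

/-- The factor `Λ` produced by `lorentz_d` meets the factor `Λ⁻¹` of the appended upper index, and
the two cancel in the contraction. -/
theorem divergence (hF : IsCovariant F) :
    IsCovariant fun I J => ∑ μ, d μ (F I (J ++ [μ])) := by
  intro Λ I J
  -- As a linear map on quasi-local expressions, `d_ν` can be moved through `tensorTransform₂`.
  have hd : ∀ ν w, deltaTerm (d ν w) =
      Finsupp.mapRange.linearMap (α := Multiset (Fin 4)) (d ν) (deltaTerm w) := by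
    intro ν w
    simp [deltaTerm]
  simp only [map_sum, lorentz_d, deltaTerm_sum, deltaTerm_smul, hd, hF Λ I (J ++ [_]),
    tensorTransform₂_snoc_right, tensorTransform₂_map, map_smul]
  rw [Finset.sum_comm]
  have hlin : (fun I' J' => ∑ μ, Finsupp.mapRange.linearMap (α := Multiset (Fin 4)) (d μ)
      (deltaTerm (F I' (J' ++ [μ])))) = ∑ μ, ((fun I' J' =>
        Finsupp.mapRange.linearMap (d μ) (deltaTerm (F I' (J' ++ [μ])))) : Cochain) := by
    funext I' J'
    simp only [Finset.sum_apply]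
  rw [hlin, map_sum]
  refine Finset.sum_congr rfl fun ν _ => ?_
  simp only [Finset.smul_sum, smul_smul]
  rw [Finset.sum_comm]
  simp only [← Finset.sum_smul, Λ.sum_mul_inv, ite_smul, one_smul, zero_smul, Finset.sum_ite_eq,
    Finset.mem_univ, if_true]

end IsCovariant

/-- A family of Wick polynomials defines a cochain supported on `δ(x₁ - x₂)`. -/
theorem isCochain_deltaTerm {k : ℤ} {F : List (Fin 4) → List (Fin 4) → Wick}
    (hleft : ∀ I₁ μ ν I₂ J, F (I₁ ++ μ :: ν :: I₂) J = -F (I₁ ++ ν :: μ :: I₂) J)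
    (hright : ∀ I J₁ μ ν J₂, F I (J₁ ++ μ :: ν :: J₂) = -F I (J₁ ++ ν :: μ :: J₂))
    (hghost : ∀ I J, F I J ∈ ghostSubmodule (I.length + J.length + k))
    (hdim : ∀ I J, F I J ∈ dimSubmodule (6 + k)) (hcov : IsCovariant F)
    (hsymm : ∀ I J, F I J = (-1 : ℂ) ^ (I.length * J.length) • F J I) :
    IsCochain k fun I J => deltaTerm (F I J) where
  antisymm_left I₁ μ ν I₂ J := by
    rw [hleft, ← neg_one_smul ℂ, deltaTerm_smul, neg_one_smul]
  antisymm_right I J₁ μ ν J₂ := by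
    rw [hright, ← neg_one_smul ℂ, deltaTerm_smul, neg_one_smul]
  ghost_number I J α := by
    by_cases hα : α = 0
    · rw [hα, deltaTerm_apply_zero]
      exact hghost I J
    · rw [deltaTerm_apply_of_ne hα]
      exact Submodule.zero_mem _
  power_counting I J α := by
    by_cases hα : α = 0
    · rw [hα, deltaTerm_apply_zero, Multiset.card_zero, Nat.cast_zero, sub_zero]
      exact hdim I J
    · rw [deltaTerm_apply_of_ne hα]
      exact Submodule.zero_mem _
  covariant Λ I J := by
    rw [lorentzQL_deltaTerm]
    exact hcov Λ I J
  symmetric I J := by rw [swap_deltaTerm, ← deltaTerm_smul, ← hsymm]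

/-! ### The coefficients of a cocycle of first order -/

/-- Since `∂_κ ∂_l δ` is symmetric, its coefficient sees only the symmetric part of `X`. On the
diagonal the coefficient is `X μ μ` alone, so this vanishes by itself. -/
theorem single_cons_singleton_apply {X : Fin 4 → Fin 4 → Wick} {μ ν : Fin 4}
    (h : ∑ κ, ∑ l, (Finsupp.single (κ ::ₘ {l}) (X κ l) : QuasiLocal) (μ ::ₘ {ν}) = 0) :
    X μ ν + X ν μ = 0 := by
  have hpair : ∀ κ l : Fin 4, κ ::ₘ ({l} : Multiset (Fin 4)) = μ ::ₘ {ν} ↔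
      (κ = μ ∧ l = ν) ∨ (κ = ν ∧ l = μ) := by
    intro κ l
    constructor
    · intro h
      rw [Multiset.cons_eq_cons] at h
      grind [Multiset.singleton_inj, Multiset.singleton_eq_cons_iff]
    · rintro (⟨rfl, rfl⟩ | ⟨rfl, rfl⟩)
      · rfl
      · exact Multiset.pair_comm _ _
  by_cases hμν : μ = ν
  · subst hμν
    have h' : X μ μ = 0 := by
      rw [← h, Finset.sum_eq_single_of_mem μ (Finset.mem_univ _),
        Finset.sum_eq_single_of_mem μ (Finset.mem_univ _), Finsupp.single_eq_same]
      · intro l _ hl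
        rw [Finsupp.single_apply, if_neg]
        simp [hpair, hl]
      · intro κ _ hκ
        refine Finset.sum_eq_zero fun l _ => ?_
        rw [Finsupp.single_apply, if_neg]
        simp [hpair, hκ]
    rw [h', add_zero]
  · rw [← h, ← Finset.sum_subset (Finset.subset_univ {μ, ν}), Finset.sum_pair hμν,
      Finset.sum_eq_single_of_mem ν (Finset.mem_univ _),
      Finset.sum_eq_single_of_mem μ (Finset.mem_univ _), Finsupp.single_eq_same,
      Finsupp.single_apply, if_pos]
    · simp [hpair]
    · intro l _ hl
      rw [Finsupp.single_apply, if_neg]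
      simp [hpair, hl, Ne.symm hμν]
    · intro l _ hl
      rw [Finsupp.single_apply, if_neg]
      simp [hpair, hl, hμν]
    · intro κ _ hκ
      simp only [Finset.mem_insert, Finset.mem_singleton, not_or] at hκ
      refine Finset.sum_eq_zero fun l _ => ?_
      rw [Finsupp.single_apply, if_neg]
      simp [hpair, hκ]

section FirstOrder

variable {R : Cochain} {N : List (Fin 4) → List (Fin 4) → Wick}
  {N₁ : List (Fin 4) → List (Fin 4) → Fin 4 → Wick}

theorem apply_zero_of_form
    (hform : ∀ I J, R I J = deltaTerm (N I J) + ∑ μ, dDeltaTerm μ (N₁ I J μ))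
    (I J : List (Fin 4)) : R I J 0 = N I J := by
  rw [hform, Finsupp.add_apply, Finsupp.finsetSum_apply, deltaTerm_apply_zero]
  simp [dDeltaTerm_apply_zero]

theorem apply_singleton_of_form
    (hform : ∀ I J, R I J = deltaTerm (N I J) + ∑ μ, dDeltaTerm μ (N₁ I J μ))
    (I J : List (Fin 4)) (ν : Fin 4) : R I J {ν} = N₁ I J ν := by
  rw [hform, Finsupp.add_apply, Finsupp.finsetSum_apply,
    deltaTerm_apply_of_ne (Multiset.singleton_ne_zero ν)]
  simp [dDeltaTerm_apply_singleton]

/-- The part of `s R = 0` of second order in the derivatives of `δ`. -/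
theorem second_order_of_form
    (hform : ∀ I J, R I J = deltaTerm (N I J) + ∑ μ, dDeltaTerm μ (N₁ I J μ))
    (hs : s R = 0) (I J : List (Fin 4)) (μ ν : Fin 4) :
    (N₁ (I ++ [μ]) J ν - (-1 : ℂ) ^ I.length • N₁ I (J ++ [μ]) ν) +
      (N₁ (I ++ [ν]) J μ - (-1 : ℂ) ^ I.length • N₁ I (J ++ [ν]) μ) = 0 := by
  refine single_cons_singleton_apply (X := fun κ l =>
    N₁ (I ++ [κ]) J l - (-1 : ℂ) ^ I.length • N₁ I (J ++ [κ]) l) ?_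
  have hone : ∀ (κ : Fin 4) (w : Wick), dDeltaTerm κ w (μ ::ₘ {ν}) = 0 := fun κ w =>
    Finsupp.single_eq_of_ne fun h => by simpa using congrArg Multiset.card h
  have hzero : ∀ w : Wick, deltaTerm w (μ ::ₘ {ν}) = 0 := fun w =>
    deltaTerm_apply_of_ne (Multiset.cons_ne_zero) w
  have h := congrArg (fun r : QuasiLocal => r (μ ::ₘ {ν})) (congrFun (congrFun hs I) J)
  -- `d_Q` does not raise the order in derivatives of `δ(x₁ - x₂)`, so the second-order part of `s
  -- R` comes from `deltaOp R` alone.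
  have hQ : gaugeQL (R I J) (μ ::ₘ {ν}) = 0 := by
    rw [gaugeQL_apply, hform, Finsupp.add_apply, Finsupp.finsetSum_apply]
    simp [hzero, hone]
  have h₁ : ∀ κ l w, partial₁ κ (dDeltaTerm l w) = Finsupp.single (κ ::ₘ {l}) w :=
    fun κ l w => partial₁_single κ {l} w
  -- Only the summand `-∂_κ` of `∂²_κ` reaches second order; it is the source of the relative minus
  -- sign in the result.
  have h₂ : ∀ κ l w, partial₂ κ (dDeltaTerm l w) =
      dDeltaTerm l (d κ w) - Finsupp.single (κ ::ₘ {l}) w :=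
    fun κ l w => partial₂_single κ {l} w
  have hδ : deltaOp R I J (μ ::ₘ {ν}) = 0 := by
    simpa [s, hQ] using h
  rw [← hδ, deltaOp]
  simp only [hform, map_add, map_sum, partial₁_deltaTerm, partial₂_deltaTerm, h₁, h₂,
    Finsupp.finsetSum_apply, Finsupp.add_apply, Finsupp.smul_apply, Finsupp.sub_apply, hone, hzero,
    zero_add, sub_self, zero_sub, Finset.sum_neg_distrib]
  refine Finset.sum_congr rfl fun κ _ => ?_
  rw [smul_neg, ← sub_eq_add_neg, Finset.smul_sum, ← Finset.sum_sub_distrib]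
  refine Finset.sum_congr rfl fun l _ => ?_
  rw [Finsupp.single_sub, Finsupp.sub_apply, ← Finsupp.smul_single, Finsupp.smul_apply]

/-- The exchange turns `∂_μδ W` into `δ d_μW - ∂_μδ W`: the first-order coefficient changes sign,
and a divergence is added at order zero. -/
theorem symm_of_form
    (hform : ∀ I J, R I J = deltaTerm (N I J) + ∑ μ, dDeltaTerm μ (N₁ I J μ))
    (hR : ∀ I J, R I J = (-1 : ℂ) ^ (I.length * J.length) • swap (R J I)) (I J : List (Fin 4)) :
    N I J = (-1 : ℂ) ^ (I.length * J.length) • (N J I + ∑ μ, d μ (N₁ J I μ)) ∧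
      ∀ ν, N₁ I J ν = -((-1 : ℂ) ^ (I.length * J.length) • N₁ J I ν) := by
  have h := hR I J
  have hsw : swap (R J I) = deltaTerm (N J I + ∑ μ, d μ (N₁ J I μ)) +
      ∑ μ, dDeltaTerm μ ((-1 : ℂ) • N₁ J I μ) := by
    rw [hform J I, map_add, map_sum, swap_deltaTerm, deltaTerm_add, deltaTerm_sum, add_assoc,
      ← Finset.sum_add_distrib]
    simp only [swap_dDeltaTerm, dDeltaTerm_smul, sub_eq_add_neg]
    simp only [neg_one_smul]
  constructor
  · have h₀ := DFunLike.congr_fun h 0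
    rw [apply_zero_of_form hform, hsw, Finsupp.smul_apply, Finsupp.add_apply,
      Finsupp.finsetSum_apply, deltaTerm_apply_zero] at h₀
    simpa [dDeltaTerm_apply_zero] using h₀
  · intro ν
    have h₁ := DFunLike.congr_fun h {ν}
    rw [apply_singleton_of_form hform, hsw, Finsupp.smul_apply, Finsupp.add_apply,
      Finsupp.finsetSum_apply, deltaTerm_apply_of_ne (Multiset.singleton_ne_zero ν)] at h₁
    simpa [dDeltaTerm_apply_singleton] using h₁

/-- The transformation of `∂_μδ` contributes a factor `Λ`; inverting it shows that the index of `N₁`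
is a further contravariant index. -/
theorem covariant_of_form
    (hform : ∀ I J, R I J = deltaTerm (N I J) + ∑ μ, dDeltaTerm μ (N₁ I J μ))
    (hR : ∀ (Λ : Lorentz) I J, lorentzQL Λ (R I J) = tensorTransform₂ Λ.toMatrix⁻¹ I J R) :
    IsCovariant N ∧ ∀ (Λ : Lorentz) I J μ, deltaTerm (lorentz Λ (N₁ I J μ)) =
      ∑ ν, Λ.toMatrix⁻¹ μ ν • tensorTransform₂ Λ.toMatrix⁻¹ I J
        fun I' J' => deltaTerm (N₁ I' J' ν) := by
  have hL : ∀ (Λ : Lorentz) I J, lorentzQL Λ (R I J) = deltaTerm (lorentz Λ (N I J)) +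
      ∑ ν, dDeltaTerm ν (∑ μ, Λ.toMatrix ν μ • lorentz Λ (N₁ I J μ)) := by
    intro Λ I J
    rw [hform, map_add, map_sum, lorentzQL_deltaTerm]
    simp only [lorentzQL_dDeltaTerm]
    rw [Finset.sum_comm]
    congr 1
    refine Finset.sum_congr rfl fun ν _ => ?_
    rw [show dDeltaTerm ν = Finsupp.lsingle (R := ℂ) (M := Wick) {ν} from rfl, map_sum]
    simp only [map_smul]
  -- The extracted coefficient is put back at order zero, so that `coeff α` takes quasi-local values
  -- and passes through `tensorTransform₂`.
  let coeff : Multiset (Fin 4) → QuasiLocal →ₗ[ℂ] QuasiLocal := fun α =>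
    Finsupp.lsingle 0 ∘ₗ Finsupp.lapply α
  have hcoeff : ∀ α r, coeff α r = deltaTerm (r α) := fun α r => rfl
  constructor
  · intro Λ I J
    have h := congrArg (coeff 0) (hR Λ I J)
    rw [tensorTransform₂_map, hcoeff, hL, Finsupp.add_apply, Finsupp.finsetSum_apply] at h
    simpa [dDeltaTerm_apply_zero, hcoeff, deltaTerm_apply_zero, apply_zero_of_form hform] using h
  · intro Λ I J μ
    have h : ∀ ν, ∑ κ, Λ.toMatrix ν κ • deltaTerm (lorentz Λ (N₁ I J κ)) =
        tensorTransform₂ Λ.toMatrix⁻¹ I J fun I' J' => deltaTerm (N₁ I' J' ν) := by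
      intro ν
      have h := congrArg (coeff {ν}) (hR Λ I J)
      rw [tensorTransform₂_map, hcoeff, hL, Finsupp.add_apply, Finsupp.finsetSum_apply,
        deltaTerm_apply_of_ne (Multiset.singleton_ne_zero ν)] at h
      simpa [dDeltaTerm_apply_singleton, hcoeff, apply_singleton_of_form hform, deltaTerm_sum,
        deltaTerm_smul] using h
    simp only [← h, Finset.smul_sum, smul_smul]
    rw [Finset.sum_comm]
    simp only [← Finset.sum_smul, Λ.sum_inv_mul, ite_smul, one_smul, zero_smul, Finset.sum_ite_eq,
      Finset.mem_univ, if_true]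

end FirstOrder

/-! ### A primitive for the coefficients of first order -/

/-- The solution of `b(T^{Iμ}, T^J) - (-1)^{|I|} b(T^I, T^{Jμ}) = -i N₁(T^I, T^J)^μ` that vanishes
for empty `I`; the first argument is the reversed sequence `I`. -/
def primitiveRev (N₁ : List (Fin 4) → List (Fin 4) → Fin 4 → Wick) :
    List (Fin 4) → List (Fin 4) → Wick
  | [], _ => 0
  | μ :: I, J => (-1 : ℂ) ^ I.length • primitiveRev N₁ I (J ++ [μ]) -
      Complex.I • N₁ I.reverse J μ

/-- The solution of `b(T^{Iμ}, T^J) - (-1)^{|I|} b(T^I, T^{Jμ}) = -i N₁(T^I, T^J)^μ` that vanishes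
for empty `I`. -/
def primitive (N₁ : List (Fin 4) → List (Fin 4) → Fin 4 → Wick) (I J : List (Fin 4)) : Wick :=
  primitiveRev N₁ I.reverse J

/-- The graded symmetric part of `primitive`. -/
def symmPrimitive (N₁ : List (Fin 4) → List (Fin 4) → Fin 4 → Wick) (I J : List (Fin 4)) : Wick :=
  (1 / 2 : ℂ) • (primitive N₁ I J + (-1 : ℂ) ^ (I.length * J.length) • primitive N₁ J I)

section Primitive

variable {N₁ : List (Fin 4) → List (Fin 4) → Fin 4 → Wick}

theorem primitive_nil (J : List (Fin 4)) : primitive N₁ [] J = 0 := rfl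

theorem primitive_snoc (I J : List (Fin 4)) (μ : Fin 4) :
    primitive N₁ (I ++ [μ]) J =
      (-1 : ℂ) ^ I.length • primitive N₁ I (J ++ [μ]) - Complex.I • N₁ I J μ := by
  simp [primitive, primitiveRev]

/-- The recursion only appends indices at the end of `J`, so a transposition inside `J` persists;
`J₂` has to vary in the induction. -/
theorem primitive_antisymm_right
    (hright : ∀ I J₁ μ ν J₂ κ, N₁ I (J₁ ++ μ :: ν :: J₂) κ = -N₁ I (J₁ ++ ν :: μ :: J₂) κ)
    (I J₁ : List (Fin 4)) (μ ν : Fin 4) (J₂ : List (Fin 4)) :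
    primitive N₁ I (J₁ ++ μ :: ν :: J₂) = -primitive N₁ I (J₁ ++ ν :: μ :: J₂) := by
  induction I using List.reverseRecOn generalizing J₂ with
  | nil => simp [primitive_nil]
  | append_singleton I κ ih =>
    have h := ih (J₂ ++ [κ])
    rw [primitive_snoc, primitive_snoc, hright, List.append_assoc, List.append_assoc]
    simp only [List.cons_append, h]
    module

/-- The essential case is a transposition of the last two indices. Unrolling the recursion twice
gives `-b(T^{I₁}, T^{Jνμ})`, antisymmetric by `primitive_antisymm_right`, plus terms in `N₁` whose
symmetric part is the combination in `hN₁`. Transpositions further inside are carried along by the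
recursion. -/
theorem primitive_antisymm_left
    (hleft : ∀ I₁ μ ν I₂ J κ, N₁ (I₁ ++ μ :: ν :: I₂) J κ = -N₁ (I₁ ++ ν :: μ :: I₂) J κ)
    (hright : ∀ I J₁ μ ν J₂ κ, N₁ I (J₁ ++ μ :: ν :: J₂) κ = -N₁ I (J₁ ++ ν :: μ :: J₂) κ)
    (hN₁ : ∀ I J μ ν, (N₁ (I ++ [μ]) J ν - (-1 : ℂ) ^ I.length • N₁ I (J ++ [μ]) ν) +
      (N₁ (I ++ [ν]) J μ - (-1 : ℂ) ^ I.length • N₁ I (J ++ [ν]) μ) = 0)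
    (I₁ : List (Fin 4)) (μ ν : Fin 4) (I₂ J : List (Fin 4)) :
    primitive N₁ (I₁ ++ μ :: ν :: I₂) J = -primitive N₁ (I₁ ++ ν :: μ :: I₂) J := by
  induction I₂ using List.reverseRecOn generalizing J with
  | nil =>
    have hsign : (-1 : ℂ) ^ I₁.length * (-1 : ℂ) ^ I₁.length = 1 := by
      rw [← mul_pow]; norm_num
    have hexp : ∀ μ ν, primitive N₁ (I₁ ++ [μ, ν]) J = -primitive N₁ I₁ (J ++ [ν, μ]) -
        Complex.I • (N₁ (I₁ ++ [μ]) J ν - (-1 : ℂ) ^ I₁.length • N₁ I₁ (J ++ [ν]) μ) := by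
      intro μ ν
      have h₁ := primitive_snoc (N₁ := N₁) (I₁ ++ [μ]) J ν
      have h₂ := primitive_snoc (N₁ := N₁) I₁ (J ++ [ν]) μ
      simp only [List.append_assoc, List.cons_append, List.nil_append, List.length_append,
        List.length_singleton] at h₁ h₂
      rw [h₁, h₂, smul_sub, smul_smul, pow_succ, mul_right_comm, hsign]
      module
    have h := primitive_antisymm_right hright I₁ J μ ν []
    rw [hexp, hexp, h]
    linear_combination (norm := module) (-Complex.I) • hN₁ I₁ J μ ν
  | append_singleton I₂ κ ih =>
    have h : ∀ μ ν, I₁ ++ μ :: ν :: (I₂ ++ [κ]) = (I₁ ++ μ :: ν :: I₂) ++ [κ] := by simp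
    rw [h, h, primitive_snoc, primitive_snoc, hleft, ih]
    simp only [List.length_append, List.length_cons]
    module

theorem primitive_mem_ghostSubmodule
    (h : ∀ I J μ, N₁ I J μ ∈ ghostSubmodule (I.length + J.length)) (I J : List (Fin 4)) :
    primitive N₁ I J ∈ ghostSubmodule (I.length + J.length + (-1)) := by
  induction I using List.reverseRecOn generalizing J with
  | nil => exact Submodule.zero_mem _
  | append_singleton I μ ih =>
    rw [primitive_snoc]
    refine Submodule.sub_mem _ (Submodule.smul_mem _ _ ?_) (Submodule.smul_mem _ _ ?_)
    · convert ih (J ++ [μ]) using 2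
      simp
      ring
    · convert h I J μ using 2
      simp
      ring

theorem primitive_mem_dimSubmodule {n : ℤ} (h : ∀ I J μ, N₁ I J μ ∈ dimSubmodule n)
    (I J : List (Fin 4)) : primitive N₁ I J ∈ dimSubmodule n := by
  induction I using List.reverseRecOn generalizing J with
  | nil => exact Submodule.zero_mem _
  | append_singleton I μ ih =>
    rw [primitive_snoc]
    exact Submodule.sub_mem _ (Submodule.smul_mem _ _ (ih _)) (Submodule.smul_mem _ _ (h I J μ))

theorem isCovariant_primitive
    (h : ∀ (Λ : Lorentz) I J μ, deltaTerm (lorentz Λ (N₁ I J μ)) =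
      ∑ ν, Λ.toMatrix⁻¹ μ ν • tensorTransform₂ Λ.toMatrix⁻¹ I J
        fun I' J' => deltaTerm (N₁ I' J' ν)) : IsCovariant (primitive N₁) := by
  intro Λ I J
  induction I using List.reverseRecOn generalizing J with
  | nil =>
    -- For empty `I` only empty `I'` contributes, so the initial value `0` is covariant although
    -- `primitive N₁` does not vanish identically in its first argument.
    have h₀ : tensorTransform₂ Λ.toMatrix⁻¹ [] J (fun I' J' => deltaTerm (primitive N₁ I' J')) =
        tensorTransform₂ Λ.toMatrix⁻¹ [] J 0 := by
      refine tensorTransform₂_congr _ _ _ fun I' J' hI _ => ?_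
      rw [List.length_eq_zero_iff.mp hI, primitive_nil, deltaTerm_zero]
      rfl
    rw [h₀, map_zero, primitive_nil, map_zero, deltaTerm_zero]
  | append_singleton I μ ih =>
    have hF : ∀ ν, tensorTransform₂ Λ.toMatrix⁻¹ I J
        (fun I' J' => deltaTerm (primitive N₁ (I' ++ [ν]) J')) =
        (-1 : ℂ) ^ I.length • tensorTransform₂ Λ.toMatrix⁻¹ I J
            (fun I' J' => deltaTerm (primitive N₁ I' (J' ++ [ν]))) -
          Complex.I • tensorTransform₂ Λ.toMatrix⁻¹ I J
            (fun I' J' => deltaTerm (N₁ I' J' ν)) := by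
      intro ν
      rw [← map_smul, ← map_smul, ← map_sub]
      refine tensorTransform₂_congr _ _ _ fun I' J' hI _ => ?_
      rw [primitive_snoc, hI, deltaTerm_sub, deltaTerm_smul, deltaTerm_smul]
      rfl
    rw [primitive_snoc, map_sub, map_smul, map_smul, deltaTerm_sub, deltaTerm_smul,
      deltaTerm_smul, ih, h, tensorTransform₂_snoc_right, tensorTransform₂_snoc_left,
      Finset.smul_sum, Finset.smul_sum, ← Finset.sum_sub_distrib]
    refine Finset.sum_congr rfl fun ν _ => ?_
    rw [hF, smul_sub, smul_comm (Λ.toMatrix⁻¹ μ ν), smul_comm (Λ.toMatrix⁻¹ μ ν)]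

theorem symmPrimitive_symm (I J : List (Fin 4)) :
    symmPrimitive N₁ I J = (-1 : ℂ) ^ (I.length * J.length) • symmPrimitive N₁ J I := by
  have hsign : (-1 : ℂ) ^ (I.length * J.length) * (-1 : ℂ) ^ (I.length * J.length) = 1 := by
    rw [← mul_pow]; norm_num
  rw [symmPrimitive, symmPrimitive, mul_comm J.length I.length,
    smul_comm _ (1 / 2 : ℂ) (_ + _), smul_add ((-1 : ℂ) ^ _), smul_smul ((-1 : ℂ) ^ _), hsign,
    one_smul, add_comm]

/-- By the graded antisymmetry `hsymm`, the graded transpose of `primitive N₁` solves the same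
inhomogeneous linear equation, and so does the average of the two solutions. -/
theorem symmPrimitive_spec
    (hsymm : ∀ I J ν, N₁ I J ν = -((-1 : ℂ) ^ (I.length * J.length) • N₁ J I ν))
    (I J : List (Fin 4)) (μ : Fin 4) :
    N₁ I J μ = Complex.I • (symmPrimitive N₁ (I ++ [μ]) J -
      (-1 : ℂ) ^ I.length • symmPrimitive N₁ I (J ++ [μ])) := by
  have h₁ : (-1 : ℂ) ^ (I.length * J.length) * (-1 : ℂ) ^ (I.length * J.length) = 1 := by
    rw [← mul_pow]; norm_num
  have h₂ : (-1 : ℂ) ^ I.length * (-1 : ℂ) ^ I.length = 1 := by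
    rw [← mul_pow]; norm_num
  have h₃ : (-1 : ℂ) ^ J.length * (-1 : ℂ) ^ J.length = 1 := by
    rw [← mul_pow]; norm_num
  have hs := hsymm J I μ
  rw [mul_comm J.length] at hs
  simp only [symmPrimitive, primitive_snoc, List.length_append, List.length_singleton, add_mul,
    mul_add, one_mul, mul_one, pow_add, hs]
  -- What remains are identities between three signs with square `1`, together with `i² = -1`.
  match_scalars <;> generalize (-1 : ℂ) ^ (I.length * J.length) = a at * <;>
    generalize (-1 : ℂ) ^ I.length = b at * <;> generalize (-1 : ℂ) ^ J.length = c at * <;>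
    have hI := Complex.I_mul_I <;> grind

theorem symmPrimitive_antisymm_left
    (hleft : ∀ I₁ μ ν I₂ J κ, N₁ (I₁ ++ μ :: ν :: I₂) J κ = -N₁ (I₁ ++ ν :: μ :: I₂) J κ)
    (hright : ∀ I J₁ μ ν J₂ κ, N₁ I (J₁ ++ μ :: ν :: J₂) κ = -N₁ I (J₁ ++ ν :: μ :: J₂) κ)
    (hN₁ : ∀ I J μ ν, (N₁ (I ++ [μ]) J ν - (-1 : ℂ) ^ I.length • N₁ I (J ++ [μ]) ν) +
      (N₁ (I ++ [ν]) J μ - (-1 : ℂ) ^ I.length • N₁ I (J ++ [ν]) μ) = 0)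
    (I₁ : List (Fin 4)) (μ ν : Fin 4) (I₂ J : List (Fin 4)) :
    symmPrimitive N₁ (I₁ ++ μ :: ν :: I₂) J = -symmPrimitive N₁ (I₁ ++ ν :: μ :: I₂) J := by
  rw [symmPrimitive, symmPrimitive, primitive_antisymm_left hleft hright hN₁,
    primitive_antisymm_right hright]
  simp only [List.length_append, List.length_cons]
  module

end Primitive

/-! ### Removing the terms of first order -/

/-- The coefficient of `δ(x₁ - x₂)` that remains of `δ N + ∂_μδ N₁^μ` after subtraction of
`s̄ (δ b)`. -/
def reducedCoeff (N b : List (Fin 4) → List (Fin 4) → Wick) (I J : List (Fin 4)) : Wick :=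
  N I J + ((-1 : ℂ) • dQ (b I J) +
    (-(Complex.I * (-1 : ℂ) ^ I.length)) • ∑ μ, d μ (b I (J ++ [μ])))

/-- The hypothesis `hb` is the cancellation of the `∂_μδ` terms. What survives of `s̄ (δ b)` is `d_Q
b` and the action of `∂²_μ` on the Wick polynomial. -/
theorem sub_sBar_deltaTerm {R : Cochain} {N b : List (Fin 4) → List (Fin 4) → Wick}
    {N₁ : List (Fin 4) → List (Fin 4) → Fin 4 → Wick}
    (hform : ∀ I J, R I J = deltaTerm (N I J) + ∑ μ, dDeltaTerm μ (N₁ I J μ))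
    (hb : ∀ I J μ, N₁ I J μ =
      Complex.I • (b (I ++ [μ]) J - (-1 : ℂ) ^ I.length • b I (J ++ [μ]))) :
    R - sBar (fun I J => deltaTerm (b I J)) = fun I J => deltaTerm (reducedCoeff N b I J) := by
  funext I J
  simp only [Pi.sub_apply, sBar, deltaOp, hform, hb, reducedCoeff, gaugeQL_deltaTerm,
    partial₁_deltaTerm, partial₂_deltaTerm, deltaTerm_add, deltaTerm_smul, deltaTerm_sum,
    dDeltaTerm_smul, dDeltaTerm_sub, smul_sub, Finset.sum_add_distrib, Finset.sum_sub_distrib,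
    smul_add, ← Finset.smul_sum]
  module

/-- The first order coefficients of a cocycle have a covariant, graded symmetric primitive. -/
theorem exists_primitive {R : Cochain} {N : List (Fin 4) → List (Fin 4) → Wick}
    {N₁ : List (Fin 4) → List (Fin 4) → Fin 4 → Wick}
    (hform : ∀ I J, R I J = deltaTerm (N I J) + ∑ μ, dDeltaTerm μ (N₁ I J μ))
    (hR : IsCocycle R) :
    ∃ b : List (Fin 4) → List (Fin 4) → Wick,
      (∀ I₁ μ ν I₂ J, b (I₁ ++ μ :: ν :: I₂) J = -b (I₁ ++ ν :: μ :: I₂) J) ∧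
      (∀ I J₁ μ ν J₂, b I (J₁ ++ μ :: ν :: J₂) = -b I (J₁ ++ ν :: μ :: J₂)) ∧
      (∀ I J, b I J ∈ ghostSubmodule (I.length + J.length + (-1))) ∧
      (∀ I J, b I J ∈ dimSubmodule (6 + -1)) ∧ IsCovariant b ∧
      (∀ I J, b I J = (-1 : ℂ) ^ (I.length * J.length) • b J I) ∧
      ∀ I J μ, N₁ I J μ =
        Complex.I • (b (I ++ [μ]) J - (-1 : ℂ) ^ I.length • b I (J ++ [μ])) := by
  obtain ⟨hC, hs⟩ := hR
  have h₁ := apply_singleton_of_form hform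
  have hleft : ∀ I₁ μ ν I₂ J κ,
      N₁ (I₁ ++ μ :: ν :: I₂) J κ = -N₁ (I₁ ++ ν :: μ :: I₂) J κ := fun I₁ μ ν I₂ J κ => by
    rw [← h₁, ← h₁, hC.antisymm_left, Finsupp.neg_apply]
  have hright : ∀ I J₁ μ ν J₂ κ,
      N₁ I (J₁ ++ μ :: ν :: J₂) κ = -N₁ I (J₁ ++ ν :: μ :: J₂) κ := fun I J₁ μ ν J₂ κ => by
    rw [← h₁, ← h₁, hC.antisymm_right, Finsupp.neg_apply]
  have hpcov := isCovariant_primitive (covariant_of_form hform hC.covariant).2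
  have hN₁ghost : ∀ I J μ, N₁ I J μ ∈ ghostSubmodule (I.length + J.length) := fun I J μ => by
    have h := hC.ghost_number I J {μ}
    rwa [h₁, add_zero] at h
  -- The one derivative on `δ` lowers the bound to `5`, which is exactly the bound for the
  -- coefficient of `δ` in degree `-1`.
  have hN₁dim : ∀ I J μ, N₁ I J μ ∈ dimSubmodule (6 + -1) := fun I J μ => by
    have h := hC.power_counting I J {μ}
    rwa [h₁, Multiset.card_singleton] at h
  have hbleft := symmPrimitive_antisymm_left hleft hright (second_order_of_form hform hs)
  have hbsymm := symmPrimitive_symm (N₁ := N₁)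
  refine ⟨symmPrimitive N₁, hbleft, fun I J₁ μ ν J₂ => ?_, fun I J => ?_, fun I J => ?_, ?_,
    hbsymm, symmPrimitive_spec fun I J => (symm_of_form hform hC.symmetric I J).2⟩
  -- Antisymmetry in `J` is antisymmetry in `I` transported by the graded symmetry; the
  -- transposition leaves the sign unchanged because lengths agree.
  · rw [hbsymm, hbsymm I, hbleft, smul_neg]
    simp only [List.length_append, List.length_cons]
  · refine Submodule.smul_mem _ _ (Submodule.add_mem _ (primitive_mem_ghostSubmodule hN₁ghost I J)
      (Submodule.smul_mem _ _ ?_))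
    rw [add_comm (I.length : ℤ)]
    exact primitive_mem_ghostSubmodule hN₁ghost J I
  · exact Submodule.smul_mem _ _ (Submodule.add_mem _ (primitive_mem_dimSubmodule hN₁dim I J)
      (Submodule.smul_mem _ _ (primitive_mem_dimSubmodule hN₁dim J I)))
  · exact (hpcov.add (hpcov.transpose.smul fun m n => (-1 : ℂ) ^ (m * n))).smul
      fun _ _ => (1 / 2 : ℂ)

/-- `N` fails to be graded symmetric by a divergence of `N₁`. Expressed through `b`, this is the
difference of the divergences of `b` in its two slots, so it exchanges the second-slot divergences
occurring in the two reduced coefficients. -/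
theorem reducedCoeff_symm {N b : List (Fin 4) → List (Fin 4) → Wick}
    {N₁ : List (Fin 4) → List (Fin 4) → Fin 4 → Wick}
    (hbspec : ∀ I J μ, N₁ I J μ =
      Complex.I • (b (I ++ [μ]) J - (-1 : ℂ) ^ I.length • b I (J ++ [μ])))
    (hbsymm : ∀ I J, b I J = (-1 : ℂ) ^ (I.length * J.length) • b J I) (I J : List (Fin 4))
    (hN : N I J = (-1 : ℂ) ^ (I.length * J.length) • (N J I + ∑ μ, d μ (N₁ J I μ))) :
    reducedCoeff N b I J = (-1 : ℂ) ^ (I.length * J.length) • reducedCoeff N b J I := by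
  have hb₁ : ∀ μ, b I (J ++ [μ]) =
      ((-1 : ℂ) ^ (I.length * J.length) * (-1 : ℂ) ^ I.length) • b (J ++ [μ]) I :=
    fun μ => by
      rw [hbsymm, List.length_append, List.length_singleton, mul_add, mul_one, pow_add]
  have hd : ∑ μ, d μ (N₁ J I μ) = Complex.I • (∑ μ, d μ (b (J ++ [μ]) I) -
      (-1 : ℂ) ^ J.length • ∑ μ, d μ (b J (I ++ [μ]))) := by
    simp only [hbspec J I, map_smul, map_sub, ← Finset.smul_sum, Finset.sum_sub_distrib]
  have hsq : (-1 : ℂ) ^ I.length * (-1 : ℂ) ^ I.length = 1 := by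
    rw [← mul_pow]; norm_num
  rw [reducedCoeff, reducedCoeff, hN, hd, hbsymm I J]
  simp only [hb₁, map_smul, ← Finset.smul_sum]
  generalize ∑ μ, d μ (b (J ++ [μ]) I) = x
  generalize ∑ μ, d μ (b J (I ++ [μ])) = y
  generalize dQ (b J I) = z
  generalize (-1 : ℂ) ^ (I.length * J.length) = a
  match_scalars <;> grind

end LinearGravity

/-! ### Reduction of a first-order cocycle to order zero -/

open LinearGravity in
theorem mainTheorem6 (R : LinearGravity.Cochain)
    (N : List (Fin 4) → List (Fin 4) → LinearGravity.Wick)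
    (N₁ : List (Fin 4) → List (Fin 4) → Fin 4 → LinearGravity.Wick)
    (hform : ∀ I J, R I J =
      LinearGravity.deltaTerm (N I J) + ∑ μ, LinearGravity.dDeltaTerm μ (N₁ I J μ))
    (hR : LinearGravity.IsCocycle R) :
    ∃ (R' : LinearGravity.Cochain) (N' : List (Fin 4) → List (Fin 4) → LinearGravity.Wick),
      LinearGravity.IsCocycle R' ∧ LinearGravity.Cohomologous R R' ∧
        ∀ I J, R' I J = LinearGravity.deltaTerm (N' I J) := by
  obtain ⟨b, hbleft, hbright, hbghost, hbdim, hbcov, hbsymm, hbspec⟩ := exists_primitive hform hR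
  obtain ⟨hC, hs⟩ := hR
  have h₀ := apply_zero_of_form hform
  have hB : IsCochain (-1) fun I J => deltaTerm (b I J) :=
    isCochain_deltaTerm hbleft hbright hbghost hbdim hbcov hbsymm
  have hred := sub_sBar_deltaTerm hform hbspec
  refine ⟨R - sBar fun I J => deltaTerm (b I J), reducedCoeff N b, ⟨?_, ?_⟩,
    ⟨_, hB, sub_sub_cancel _ _⟩, fun I J => congrFun (congrFun hred I) J⟩
  -- The cochain conditions are verified on the explicit coefficient, which avoids proving that `s̄`
  -- maps cochains to cochains in general.
  · rw [hred]
    refine isCochain_deltaTerm ?_ ?_ ?_ ?_ ?_ ?_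
    · intro I₁ μ ν I₂ J
      have hN : N (I₁ ++ μ :: ν :: I₂) J = -N (I₁ ++ ν :: μ :: I₂) J := by
        rw [← h₀, ← h₀, hC.antisymm_left, Finsupp.neg_apply]
      simp only [reducedCoeff, hN, hbleft I₁ μ ν, map_neg, Finset.sum_neg_distrib,
        List.length_append, List.length_cons]
      module
    · intro I J₁ μ ν J₂
      have hN : N I (J₁ ++ μ :: ν :: J₂) = -N I (J₁ ++ ν :: μ :: J₂) := by
        rw [← h₀, ← h₀, hC.antisymm_right, Finsupp.neg_apply]
      have hbr : ∀ κ, b I (J₁ ++ μ :: ν :: J₂ ++ [κ]) = -b I (J₁ ++ ν :: μ :: J₂ ++ [κ]) :=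
        fun κ => by simpa using hbright I J₁ μ ν (J₂ ++ [κ])
      simp only [reducedCoeff, hN, hbright I J₁ μ ν J₂, hbr, map_neg, Finset.sum_neg_distrib]
      module
    · intro I J
      refine Submodule.add_mem _ ?_ (Submodule.add_mem _ (Submodule.smul_mem _ _ ?_)
        (Submodule.smul_mem _ _ (Submodule.sum_mem _ fun μ _ => d_mem_ghostSubmodule μ ?_)))
      · rw [← h₀]
        exact hC.ghost_number I J 0
      · have h := dQ_mem_ghostSubmodule (hbghost I J)
        rwa [neg_add_cancel_right, ← add_zero ((I.length : ℤ) + J.length)] at h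
      · convert hbghost I (J ++ [μ]) using 2
        simp
        ring
    · intro I J
      -- `d_Q` and `d_μ` each raise the dimension by one, from the bound `5` for `b` to the bound
      -- `6` in degree `0`.
      have hdim : (6 + -1 + 1 : ℤ) = 6 + 0 := by norm_num
      refine Submodule.add_mem _ ?_ (Submodule.add_mem _ (Submodule.smul_mem _ _ ?_)
        (Submodule.smul_mem _ _ (Submodule.sum_mem _ fun μ _ => ?_)))
      · have h := hC.power_counting I J 0
        rwa [h₀, Multiset.card_zero, Nat.cast_zero, sub_zero] at h
      · rw [← hdim]
        exact dQ_mem_dimSubmodule (hbdim I J)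
      · rw [← hdim]
        exact d_mem_dimSubmodule μ (hbdim I (J ++ [μ]))
    · exact (covariant_of_form hform hC.covariant).1.add ((hbcov.gauge.smul fun _ _ => -1).add
        (hbcov.divergence.smul fun m _ => -(Complex.I * (-1 : ℂ) ^ m)))
    · exact fun I J => reducedCoeff_symm hbspec hbsymm I J (symm_of_form hform hC.symmetric I J).1
  · rw [s_sub, hs, s_sBar hB.antisymm_left hB.antisymm_right, sub_zero]

end
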